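/- Let $(x_0,y_0)\in\mathbb R^2$, and let $\mathcal R_{(x_0,y_0)}$ be the real algebra of all rational functions $g=p/q\in\mathbb R(x,y)$ ($p,q$ coprime polynomials) that are bounded in some neighbourhood of $(x_0,y_0)$; where $q$ vanishes, the value of $g$ is, by convention, the iterated limit $g(a,b)=\lim_{x\to a}\lim_{y\to b}g(x,y)$ whenever this exists and is finite. For $f\in\mathcal R_{(x_0,y_0)}$ let $D_f(x_0,y_0)=\bigcap_V\overline{f(V)}$, where $V$ runs over all neighbourhoods of $(x_0,y_0)$, be the set of limiting values of $f$ at $(x_0,y_0)$. Let $\mathcal I$ be the set of all functions $\Phi(t)=\sum_{k=1}^N\varphi_k|t|^{e_k}$ with $N\ge 0$, $\varphi_k\in\mathbb R\setminus\{0\}$, $e_k\in\mathbb Q$ and $1\le e_1<\dots<e_N$ (so $\Phi=0$ for $N=0$). A character of $\mathcal R_{(x_0,y_0)}$ is a nontrivial homomorphism of real algebras $\chi:\mathcal R_{(x_0,y_0)}\to\mathbb R$. It is determined by a net $(x_\gamma,y_\gamma)\to(x_0,y_0)$ if $\chi(g)=\lim_\gamma g(x_\gamma,y_\gamma)$ for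 all $g\in\mathcal R_{(x_0,y_0)}$, and by a branch of a curve through $(x_0,y_0)$ if $\chi(g)$ is the limit of $g$ along that branch at $(x_0,y_0)$ for all $g\in\mathcal R_{(x_0,y_0)}$. Let $X^1_{(x_0,y_0)}$ be the set of characters determined by a net $(x_\gamma,y_\gamma)\to(x_0,y_0)$ such that either $x_\gamma-x_0$ has a constant strict sign, $\frac{y_\gamma-y_0}{x_\gamma-x_0}$ has a finite limit, and for some $\Phi\in\mathcal I$ one has $\lim_\gamma\frac{y_\gamma-y_0-\Phi(x_\gamma-x_0)}{|x_\gamma-x_0|^{e}}=0$ for every $e\in\mathbb R$, or the same holds with the roles of $x$ and $y$ exchanged. Theorem. For every $f\in\mathcal R_{(x_0,y_0)}$ and every $d\in D_f(x_0,y_0)$ there is a character $\chi\in X^1_{(x_0,y_0)}$ with $\chi(f)=d$; moreover, $\chi$ can be chosen so that for some $\Phi\in\mathcal I$ it is determined by one of the branches $x>x_0$, $x<x_0$ of the curve $y=y_0+\Phi(x-x_0)$ or by one of the branches $y>y_0$, $y<y_0$ of the curve $x=x_0+\Phi(y-y_0)$. In particular, $f$ tends to $d$ along that branch. -/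

import Mathlib

open Filter Topology

noncomputable section

namespace RatLim

/-- Real polynomials in two variables; variable `0` is `x` and variable `1` is `y`. -/
abbrev Poly2 : Type := MvPolynomial (Fin 2) ℝ

/-- The real rational functions in two variables. -/
abbrev Rat2 : Type := FractionRing Poly2

/-- The value `p(x, y)` of a polynomial at the point `w = (x, y)`. -/
def pval (p : Poly2) (w : ℝ × ℝ) : ℝ := MvPolynomial.eval ![w.1, w.2] p

/-- The numerator in the representation `f = p / q` with `p`, `q` mutually prime. -/
def num (f : Rat2) : Poly2 := IsFractionRing.num Poly2 f

/-- The denominator in the representation `f = p / q` with `p`, `q` mutually prime. -/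
def den (f : Rat2) : Poly2 := (IsFractionRing.den Poly2 f : Poly2)

/-- The quotient `p(w) / q(w)` for the reduced representation `f = p / q`; it is the value of `f`
at `w` when `q(w) ≠ 0`. -/
def quot (f : Rat2) (w : ℝ × ℝ) : ℝ := pval (num f) w / pval (den f) w

open Classical in
/-- The value of `f` at `w`: `p(w) / q(w)` where the denominator of the reduced representation does
not vanish, and the iterated limit `lim_{x → w₁} lim_{y → w₂} f(x, y)` otherwise. (This is the
convention that defines a rational function at its points of bounded discontinuity.) -/
def value (f : Rat2) (w : ℝ × ℝ) : ℝ :=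
  if pval (den f) w ≠ 0 then quot f w
  else limUnder (𝓝[≠] w.1) fun x => limUnder (𝓝[≠] w.2) fun y => quot f (x, y)

/-- `f` is bounded in some neighbourhood of `z`. Points where the reduced denominator vanishes are
left out: the values there, if any, are limits of values at the other points, so they obey the
same bound. -/
def BoundedNear (f : Rat2) (z : ℝ × ℝ) : Prop :=
  ∃ C : ℝ, ∀ᶠ w in 𝓝 z, pval (den f) w ≠ 0 → |quot f w| ≤ C

lemma continuous_pval (p : Poly2) : Continuous (pval p) := by
  unfold pval
  refine (MvPolynomial.continuous_eval p).comp ?_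
  refine continuous_pi fun i => ?_
  fin_cases i
  · exact continuous_fst
  · exact continuous_snd

lemma dense_pval_ne_zero {q : Poly2} (hq : q ≠ 0) : Dense {w : ℝ × ℝ | pval q w ≠ 0} := by
  intro w
  rw [mem_closure_iff_nhds]
  intro U hU
  by_contra hne
  rw [Set.not_nonempty_iff_eq_empty] at hne
  have hzero : ∀ v ∈ U, pval q v = 0 := by
    intro v hv
    by_contra h
    exact (Set.eq_empty_iff_forall_notMem.mp hne v) ⟨hv, h⟩
  rw [nhds_prod_eq] at hU
  obtain ⟨A, hA, B, hB, hAB⟩ := Filter.mem_prod_iff.mp hU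
  refine hq (MvPolynomial.funext_set ![A, B] ?_ ?_)
  · intro i
    fin_cases i
    · exact infinite_of_mem_nhds _ hA
    · exact infinite_of_mem_nhds _ hB
  · intro v hv
    have h0 : v 0 ∈ A := hv 0 (Set.mem_univ _)
    have h1 : v 1 ∈ B := hv 1 (Set.mem_univ _)
    have h := hzero (v 0, v 1) (hAB ⟨h0, h1⟩)
    have hvv : ![v 0, v 1] = v := by
      ext i
      fin_cases i <;> rfl
    simpa [pval, hvv] using h

lemma den_ne_zero (f : Rat2) : den f ≠ 0 := nonZeroDivisors.coe_ne_zero _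

lemma num_div_den (f : Rat2) :
    algebraMap Poly2 Rat2 (num f) / algebraMap Poly2 Rat2 (den f) = f :=
  IsFractionRing.mk'_num_den' Poly2 f

lemma boundedNear_of_eq_div {f : Rat2} {z : ℝ × ℝ} (a b : Poly2) (hb : b ≠ 0)
    (hf : f = algebraMap Poly2 Rat2 a / algebraMap Poly2 Rat2 b) (C : ℝ)
    (hC : ∀ᶠ w in 𝓝 z, pval b w ≠ 0 → |pval a w / pval b w| ≤ C) : BoundedNear f z := by
  have inj := IsFractionRing.injective Poly2 Rat2
  have hcross : num f * b = a * den f := by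
    apply inj
    have hb' : algebraMap Poly2 Rat2 b ≠ 0 := by
      simpa using (map_ne_zero_iff _ inj).mpr hb
    have hd' : algebraMap Poly2 Rat2 (den f) ≠ 0 := (map_ne_zero_iff _ inj).mpr (den_ne_zero f)
    have := (num_div_den f).trans hf
    rw [div_eq_div_iff hd' hb'] at this
    simpa [map_mul] using this
  refine ⟨C, ?_⟩
  filter_upwards [hC.eventually_nhds] with w hw hdw
  have hcont : ContinuousAt (fun v => |quot f v|) w :=
    (((continuous_pval _).continuousAt).div ((continuous_pval _).continuousAt) hdw).abs
  by_contra hlt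
  push Not at hlt
  have h1 : ∀ᶠ v in 𝓝 w, C < |quot f v| := hcont.eventually (lt_mem_nhds hlt)
  have h2 : ∀ᶠ v in 𝓝 w, pval (den f) v ≠ 0 :=
    (continuous_pval _).continuousAt.eventually_ne hdw
  obtain ⟨v, ⟨⟨hv1, hv2⟩, hv3⟩, hv4⟩ :=
    mem_closure_iff_nhds.mp (dense_pval_ne_zero hb w) _ ((h1.and h2).and hw)
  have hv4' : pval b v ≠ 0 := hv4
  have hev : pval (num f) v * pval b v = pval a v * pval (den f) v := by
    have := congrArg (fun p => pval p v) hcross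
    simpa [pval] using this
  have : quot f v = pval a v / pval b v := by
    unfold quot
    rw [div_eq_div_iff hv2 hv4']
    exact hev
  have := hv3 hv4'
  simp_all only [ne_eq, not_false_eq_true]
  linarith

/-- The real algebra of the rational functions that are bounded in some neighbourhood of `z`. -/
def boundedRat (z : ℝ × ℝ) : Subalgebra ℝ Rat2 where
  carrier := {f | BoundedNear f z}
  mul_mem' := by
    rintro f g ⟨C, hC⟩ ⟨D, hD⟩
    refine boundedNear_of_eq_div (num f * num g) (den f * den g)
      (mul_ne_zero (den_ne_zero f) (den_ne_zero g)) ?_ (C * D) ?_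
    · rw [map_mul, map_mul, mul_div_mul_comm, num_div_den, num_div_den]
    · filter_upwards [hC, hD] with w hf hg hne
      simp only [pval, map_mul] at hne ⊢
      have h1 := hf (left_ne_zero_of_mul hne)
      have h2 := hg (right_ne_zero_of_mul hne)
      rw [mul_div_mul_comm, abs_mul]
      exact mul_le_mul h1 h2 (abs_nonneg _) ((abs_nonneg _).trans h1)
  add_mem' := by
    rintro f g ⟨C, hC⟩ ⟨D, hD⟩
    have inj := IsFractionRing.injective Poly2 Rat2
    refine boundedNear_of_eq_div (num f * den g + den f * num g) (den f * den g)
      (mul_ne_zero (den_ne_zero f) (den_ne_zero g)) ?_ (C + D) ?_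
    · rw [map_mul, map_add, map_mul, map_mul, ← div_add_div _ _
        ((map_ne_zero_iff _ inj).mpr (den_ne_zero f))
        ((map_ne_zero_iff _ inj).mpr (den_ne_zero g)), num_div_den, num_div_den]
    · filter_upwards [hC, hD] with w hf hg hne
      simp only [pval, map_mul, map_add] at hne ⊢
      have h1 := hf (left_ne_zero_of_mul hne)
      have h2 := hg (right_ne_zero_of_mul hne)
      rw [← div_add_div _ _ (left_ne_zero_of_mul hne) (right_ne_zero_of_mul hne)]
      exact (abs_add_le _ _).trans (add_le_add h1 h2)
  algebraMap_mem' := by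
    intro r
    refine boundedNear_of_eq_div (MvPolynomial.C r) 1 one_ne_zero ?_ |r| ?_
    · rw [map_one, div_one]
      exact IsScalarTower.algebraMap_apply ℝ Poly2 Rat2 r
    · exact Filter.Eventually.of_forall fun w _ => by simp [pval]

/-- The set of limiting values of `f` at `z`: the intersection of the closures of `f(V)` over all
neighbourhoods `V` of `z`. -/
def limitingValues (f : Rat2) (z : ℝ × ℝ) : Set ℝ :=
  ⋂ V ∈ 𝓝 z, closure (value f '' V)

/-- The (nontrivial) real characters of the algebra of rational functions bounded near `z`. -/
abbrev Character (z : ℝ × ℝ) : Type := boundedRat z →ₐ[ℝ] ℝ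

/-- The finite sums `Φ(t) = ∑ₖ φₖ |t| ^ eₖ` with nonzero real coefficients `φₖ` and strictly
increasing rational exponents `eₖ ≥ 1`; the empty sum `Φ = 0` is included. -/
def puiseuxSums : Set (ℝ → ℝ) :=
  {Φ | ∃ (N : ℕ) (φ : Fin N → ℝ) (e : Fin N → ℚ), (∀ k, φ k ≠ 0) ∧ (∀ k, 1 ≤ e k) ∧
    StrictMono e ∧ Φ = fun t => ∑ k, φ k * |t| ^ ((e k : ℚ) : ℝ)}

/-- `χ` is determined by the family of points `γ` along the filter `l`: the points tend to `z`, and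
`χ(g)` is the limit of `g` along the family for every `g` in the algebra. -/
def DeterminedAlong {ι : Type} {z : ℝ × ℝ} (χ : Character z) (l : Filter ι) (γ : ι → ℝ × ℝ) :
    Prop :=
  Tendsto γ l (𝓝 z) ∧ ∀ g : boundedRat z, Tendsto (fun i => value (g : Rat2) (γ i)) l (𝓝 (χ g))

/-- `χ` is determined by one of the two branches (`x > x₀` or `x < x₀`) of the curve
`y = y₀ + Φ(x - x₀)`. -/
def DeterminedByGraphX {x₀ y₀ : ℝ} (χ : Character (x₀, y₀)) (Φ : ℝ → ℝ) : Prop :=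
  DeterminedAlong χ (𝓝[>] x₀) (fun x => (x, y₀ + Φ (x - x₀))) ∨
  DeterminedAlong χ (𝓝[<] x₀) (fun x => (x, y₀ + Φ (x - x₀)))

/-- `χ` is determined by one of the two branches (`y > y₀` or `y < y₀`) of the curve
`x = x₀ + Φ(y - y₀)`. -/
def DeterminedByGraphY {x₀ y₀ : ℝ} (χ : Character (x₀, y₀)) (Φ : ℝ → ℝ) : Prop :=
  DeterminedAlong χ (𝓝[>] y₀) (fun y => (x₀ + Φ (y - y₀), y)) ∨
  DeterminedAlong χ (𝓝[<] y₀) (fun y => (x₀ + Φ (y - y₀), y))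

/-- The condition on a family of pairs `(u, v)` (along `l`) that `u` keeps a strict sign, `v / u` has
a finite limit, and `v` agrees with `Φ(u)` to every order: `(v - Φ(u)) / |u| ^ e → 0` for every
real `e`, for some finite sum `Φ` of rational powers. -/
def FlatToPuiseuxSum {ι : Type} (l : Filter ι) (u v : ι → ℝ) : Prop :=
  ((∀ i, 0 < u i) ∨ (∀ i, u i < 0)) ∧
  (∃ c : ℝ, Tendsto (fun i => v i / u i) l (𝓝 c)) ∧
  ∃ Φ ∈ puiseuxSums, ∀ e : ℝ, Tendsto (fun i => (v i - Φ (u i)) / |u i| ^ e) l (𝓝 0)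

/-- The class `X¹` of characters at `(x₀, y₀)`: those determined by a net of points that tends to
`(x₀, y₀)` and agrees to every order with a curve `y = y₀ + Φ(x - x₀)` or `x = x₀ + Φ(y - y₀)`. -/
def X1 (x₀ y₀ : ℝ) : Set (Character (x₀, y₀)) :=
  {χ | ∃ (Γ : Type) (_ : Preorder Γ) (_ : IsDirectedOrder Γ) (_ : Nonempty Γ) (γ : Γ → ℝ × ℝ),
    DeterminedAlong χ atTop γ ∧
    (FlatToPuiseuxSum atTop (fun i => (γ i).1 - x₀) (fun i => (γ i).2 - y₀) ∨
     FlatToPuiseuxSum atTop (fun i => (γ i).2 - y₀) (fun i => (γ i).1 - x₀))}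

end RatLim

end

/-!
A limiting value `d` of `f = P / Q` is its limit along an ultrafilter of points other than the
centre. The ultrafilter contains one of the four cones `|v| ≤ t` around the half axes, and there we
follow it through weighted blow-ups `t = τ ^ m`, `v = τ ^ k * (w + c)` along the first side of the
Newton polygon of `Q`. Since `f` is bounded, every power of `τ` that divides the transform of `Q`
also divides that of `P`, so both can be divided by it. Each blow-up lowers the order at the new
centre of the restriction of `Q` to the line `τ = 0`, or else does not raise it and lowers a bound
for the order in `t` to which `Q` can vanish on `t > 0`. Such a bound exists because a combination
of `P` and `Q` is a nonzero polynomial in `t` alone. The descent ends when `Q ≠ 0` at the centre or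
`w` is unbounded along the ultrafilter, and then `d` is also the limit of `f` along an explicit
branch. Composing the substitutions turns this into a branch `t = τ ^ m`, `v = τ ^ m * g(τ)`, which
is the graph of an element of `puiseuxSums`, and the limits along it of all locally bounded rational
functions form the character.
-/

noncomputable section

namespace RatLim

open Polynomial Asymptotics

section PowersOfX

lemma exists_eq_X_pow_mul {r : ℝ[X]} (hr : r ≠ 0) :
    ∃ (n : ℕ) (s : ℝ[X]), s.eval 0 ≠ 0 ∧ r = X ^ n * s := by
  obtain ⟨n, s, hs, h⟩ := WfDvdMonoid.max_power_factor hr (irreducible_X (R := ℝ))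
  exact ⟨n, s, by rwa [X_dvd_iff, coeff_zero_eq_eval_zero] at hs, h⟩

lemma X_pow_dvd_of_isBigO {A B : ℝ[X]} {N : ℕ} {l : Filter ℝ} [l.NeBot] (hl : l ≤ 𝓝[≠] 0)
    (h : (fun t => A.eval t) =O[l] fun t => t ^ N * B.eval t) : X ^ N ∣ A := by
  rcases eq_or_ne A 0 with rfl | hA
  · exact dvd_zero _
  obtain ⟨e, s, hs, rfl⟩ := exists_eq_X_pow_mul hA
  obtain hle | ⟨n, rfl⟩ : N ≤ e ∨ ∃ n, N = e + (n + 1) :=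
    (le_or_gt N e).imp_right fun hlt => ⟨N - e - 1, by omega⟩
  · exact (pow_dvd_pow X hle).mul_right s
  have hlim (p : ℝ[X]) : Tendsto (fun t => p.eval t) l (𝓝 (p.eval 0)) :=
    (p.continuous.tendsto 0).mono_left (hl.trans nhdsWithin_le_nhds)
  have hdom : (fun t => s.eval t) =O[l] fun t => t ^ (n + 1) * B.eval t := by
    obtain ⟨K, hK⟩ := h.bound
    refine .of_bound K ?_
    filter_upwards [hK, hl self_mem_nhdsWithin] with t ht (ht0 : t ≠ 0)
    refine le_of_mul_le_mul_left ?_ (pow_pos (norm_pos_iff.mpr ht0) e)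
    simpa only [eval_mul, eval_pow, eval_X, norm_mul, norm_pow, pow_add, mul_assoc,
      mul_left_comm K] using ht
  have hzero := hlim (X ^ (n + 1) * B)
  simp only [eval_mul, eval_pow, eval_X, zero_pow n.succ_ne_zero, zero_mul] at hzero
  exact absurd (tendsto_nhds_unique (hlim s) (hdom.trans_tendsto hzero)) hs

lemma X_pow_dvd_expand {r : ℝ[X]} {e : ℕ} (m : ℕ) (h : X ^ e ∣ r) :
    X ^ (m * e) ∣ expand ℝ m r := by
  obtain ⟨s, rfl⟩ := h
  exact ⟨expand ℝ m s, by rw [map_mul, map_pow, expand_X, pow_mul]⟩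

end PowersOfX

section EvalEval

lemma eval_eval_eq_evalEval (G : ℝ[X][X]) (h : ℝ[X]) (t : ℝ) :
    (G.eval h).eval t = G.evalEval t (h.eval t) := by
  rw [← eval₂_evalRingHom]
  simpa using hom_eval₂ G (RingHom.id _) (evalRingHom t) h

lemma continuous_evalEval (G : ℝ[X][X]) : Continuous fun w : ℝ × ℝ => G.evalEval w.1 w.2 := by
  simp only [← map_evalRingHom_eval, eval_map, eval₂_eq_sum, Polynomial.sum_def, coe_evalRingHom]
  fun_prop

lemma tendsto_evalEval (G : ℝ[X][X]) {ι : Type*} {l : Filter ι} {t s : ι → ℝ} {a b : ℝ}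
    (ht : Tendsto t l (𝓝 a)) (hs : Tendsto s l (𝓝 b)) :
    Tendsto (fun i => G.evalEval (t i) (s i)) l (𝓝 (G.evalEval a b)) :=
  ((continuous_evalEval G).tendsto (a, b)).comp (ht.prodMk_nhds hs)

lemma evalEval_eq_sum_range (G : ℝ[X][X]) (t v : ℝ) :
    G.evalEval t v = ∑ j ∈ Finset.range (G.natDegree + 1), (G.coeff j).eval t * v ^ j := by
  rw [evalEval, eval_eq_sum_range (p := G), eval_finsetSum]
  simp only [eval_mul, eval_pow, eval_C]

lemma evalEval_taylor (G : ℝ[X][X]) (h : ℝ[X]) (t v : ℝ) :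
    (taylor h G).evalEval t v = G.evalEval t (v + h.eval t) := by
  rw [evalEval, taylor_eval, eval_eval_eq_evalEval, eval_add, eval_C]

end EvalEval

section SpecialFiber

/-- The restriction `G(0, ·)` of a polynomial `G(t, v)` to the line `t = 0`. -/
def specialFiber (G : ℝ[X][X]) : ℝ[X] := G.map (evalRingHom 0)

lemma coeff_specialFiber (G : ℝ[X][X]) (j : ℕ) :
    (specialFiber G).coeff j = (G.coeff j).eval 0 := coeff_map _ _

lemma eval_specialFiber (G : ℝ[X][X]) (v : ℝ) : (specialFiber G).eval v = G.evalEval 0 v :=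
  map_evalRingHom_eval 0 v G

lemma specialFiber_taylor (G : ℝ[X][X]) (c : ℝ) :
    specialFiber (taylor (C c) G) = taylor c (specialFiber G) := by
  simp [specialFiber, taylor_apply, Polynomial.map_comp]

lemma specialFiber_ne_zero_iff {G : ℝ[X][X]} : specialFiber G ≠ 0 ↔ ¬ C X ∣ G := by
  rw [C_dvd_iff_dvd_coeff, not_iff_not, Polynomial.ext_iff]
  simp only [coeff_specialFiber, coeff_zero, X_dvd_iff, coeff_zero_eq_eval_zero]

lemma exists_eq_C_X_pow_mul {G : ℝ[X][X]} (hG : G ≠ 0) :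
    ∃ (n : ℕ) (H : ℝ[X][X]), specialFiber H ≠ 0 ∧ G = C (X ^ n) * H := by
  have hX : Prime (C X : ℝ[X][X]) := prime_C_iff.mpr prime_X
  obtain ⟨n, H, hH, h⟩ := WfDvdMonoid.max_power_factor hG hX.irreducible
  exact ⟨n, H, specialFiber_ne_zero_iff.mpr hH, by rw [h, C_pow]⟩

lemma C_X_pow_dvd_of_isBigO {F H : ℝ[X][X]} {N : ℕ}
    (h : ∀ v, (fun t => F.evalEval t v) =O[𝓝[>] 0] fun t => t ^ N * H.evalEval t v) :
    C (X ^ N) ∣ F := by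
  rcases eq_or_ne F 0 with rfl | hF
  · exact dvd_zero _
  obtain ⟨e, G, hG, rfl⟩ := exists_eq_C_X_pow_mul hF
  obtain ⟨v, hv⟩ : ∃ v, G.evalEval 0 v ≠ 0 := by
    by_contra! h0
    exact hG (Polynomial.funext fun v => by rw [eval_specialFiber, h0, eval_zero])
  have hdvd : X ^ N ∣ X ^ e * G.eval (C v) := by
    refine X_pow_dvd_of_isBigO (B := H.eval (C v)) (nhdsGT_le_nhdsNE 0) ?_
    simpa only [eval_mul, eval_pow, eval_X, evalEval_mul, evalEval_C, eval_eval_eq_evalEval,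
      eval_C] using h v
  refine (_root_.map_dvd C ?_).mul_right G
  refine prime_X.pow_dvd_of_dvd_mul_right N (fun hX => hv ?_) hdvd
  rwa [X_dvd_iff, coeff_zero_eq_eval_zero, eval_eval_eq_evalEval, eval_C] at hX

end SpecialFiber

section Blowup

/-- The pullback of `G(t, v)` under the weighted blow-up `t = τ ^ m`, `v = τ ^ k * w`. -/
def blowup (m k : ℕ) (G : ℝ[X][X]) : ℝ[X][X] :=
  (G.map (expand ℝ m : ℝ[X] →+* ℝ[X])).comp (C (X ^ k) * X)

lemma coeff_blowup (m k : ℕ) (G : ℝ[X][X]) (j : ℕ) :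
    (blowup m k G).coeff j = expand ℝ m (G.coeff j) * X ^ (k * j) := by
  rw [blowup, comp_C_mul_X_coeff, coeff_map, ← pow_mul]
  rfl

lemma evalEval_blowup (m k : ℕ) (G : ℝ[X][X]) (τ w : ℝ) :
    (blowup m k G).evalEval τ w = G.evalEval (τ ^ m) (τ ^ k * w) := by
  rw [blowup, evalEval, eval_comp, eval_map, ← eval₂_evalRingHom, ← coe_evalRingHom, hom_eval₂]
  congr 1
  · ext <;> simp
  · simp only [eval_mul, eval_C, eval_X, coe_evalRingHom, eval_pow]

variable {m k μ : ℕ} {G G₁ : ℝ[X][X]}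

lemma coeff_of_blowup_eq (h : blowup m k G = C (X ^ (k * μ)) * G₁) (j : ℕ) :
    X ^ (k * μ) * G₁.coeff j = X ^ (k * j) * expand ℝ m (G.coeff j) := by
  rw [← coeff_C_mul, ← h, coeff_blowup, mul_comm]

lemma expand_coeff_of_blowup_eq (h : blowup m k G = C (X ^ (k * μ)) * G₁) {j : ℕ} (hj : j ≤ μ) :
    expand ℝ m (G.coeff j) = X ^ (k * (μ - j)) * G₁.coeff j := by
  refine mul_left_cancel₀ (pow_ne_zero (k * j) X_ne_zero) ?_
  rw [← coeff_of_blowup_eq h, ← mul_assoc, ← pow_add, ← mul_add, Nat.add_sub_cancel' hj]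

lemma coeff_specialFiber_of_blowup_eq (hm : m ≠ 0) (h : blowup m k G = C (X ^ (k * μ)) * G₁) :
    (specialFiber G₁).coeff μ = (specialFiber G).coeff μ := by
  have := congrArg (eval 0) (expand_coeff_of_blowup_eq h le_rfl)
  simpa [coeff_specialFiber, expand_eval, hm] using this.symm

lemma natDegree_specialFiber_of_blowup_eq (hk : k ≠ 0)
    (h : blowup m k G = C (X ^ (k * μ)) * G₁) : (specialFiber G₁).natDegree ≤ μ := by
  refine natDegree_le_iff_coeff_eq_zero.mpr fun j hj => ?_
  have hcoeff : G₁.coeff j = X ^ (k * (j - μ)) * expand ℝ m (G.coeff j) := by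
    refine mul_left_cancel₀ (pow_ne_zero (k * μ) X_ne_zero) ?_
    rw [coeff_of_blowup_eq h, ← mul_assoc, ← pow_add, ← mul_add, Nat.add_sub_cancel' hj.le]
  simp [coeff_specialFiber, hcoeff, hk, Nat.sub_ne_zero_of_lt hj]

lemma exists_blowup_eq (h : ∀ j < μ, X ^ (k * (μ - j)) ∣ expand ℝ m (G.coeff j)) :
    ∃ G₁, blowup m k G = C (X ^ (k * μ)) * G₁ := by
  refine (C_dvd_iff_dvd_coeff _ _).mpr fun j => ?_
  rw [coeff_blowup]
  rcases lt_or_ge j μ with hj | hj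
  · rw [← Nat.sub_add_cancel hj.le, mul_add, pow_add]
    exact mul_dvd_mul (h j hj) dvd_rfl
  · exact (pow_dvd_pow X (Nat.mul_le_mul_left k hj)).mul_left _

/-- Along a family with `|v|` of larger order than `τ ^ k`, that is, leaving every bounded part of
the chart `w = v / τ ^ k`, only the term of degree `μ` of `G(τ ^ m, v) / v ^ μ` survives. -/
lemma tendsto_div_pow_of_blowup_eq (hm : m ≠ 0) (h : blowup m k G = C (X ^ (k * μ)) * G₁)
    {ι : Type*} {l : Filter ι} {τ v : ι → ℝ} (hτ : Tendsto τ l (𝓝 0)) (hv : Tendsto v l (𝓝 0))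
    (hv0 : ∀ᶠ i in l, v i ≠ 0) (hsteep : Tendsto (fun i => τ i ^ k / v i) l (𝓝 0)) :
    Tendsto (fun i => G.evalEval (τ i ^ m) (v i) / v i ^ μ) l (𝓝 ((specialFiber G).coeff μ)) := by
  have hcoeff (p : ℝ[X]) : Tendsto (fun i => p.eval (τ i)) l (𝓝 (p.eval 0)) :=
    (p.continuous.tendsto 0).comp hτ
  have hterm (j : ℕ) : Tendsto (fun i => (G.coeff j).eval (τ i ^ m) * v i ^ j / v i ^ μ) l
      (𝓝 (if j = μ then (specialFiber G).coeff μ else 0)) := by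
    simp only [← expand_eval]
    rcases lt_trichotomy j μ with hj | rfl | hj
    · rw [if_neg hj.ne]
      have hlim := (hcoeff (G₁.coeff j)).mul (hsteep.pow (μ - j))
      rw [zero_pow (Nat.sub_ne_zero_of_lt hj), mul_zero] at hlim
      refine hlim.congr' (hv0.mono fun i hi => ?_)
      simp only [expand_coeff_of_blowup_eq h hj.le, ← pow_sub_mul_pow (v i) hj.le, div_pow,
        eval_mul, eval_pow, eval_X, pow_mul]
      field_simp
    · rw [if_pos rfl, coeff_specialFiber]
      have hlim := hcoeff (expand ℝ m (G.coeff j))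
      rw [expand_eval m _ 0, zero_pow hm] at hlim
      exact hlim.congr' (hv0.mono fun i hi => (mul_div_cancel_right₀ _ (pow_ne_zero j hi)).symm)
    · rw [if_neg hj.ne']
      have hlim := (hcoeff (expand ℝ m (G.coeff j))).mul (hv.pow (j - μ))
      rw [zero_pow (Nat.sub_ne_zero_of_lt hj), mul_zero] at hlim
      refine hlim.congr' (hv0.mono fun i hi => ?_)
      simp only [← pow_sub_mul_pow (v i) hj.le]
      field_simp
  have hsum := tendsto_finsetSum (Finset.range (G.natDegree + 1)) fun j _ => hterm j
  simp only [evalEval_eq_sum_range, Finset.sum_div]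
  rw [Finset.sum_ite_eq'] at hsum
  convert hsum using 2
  refine (ite_eq_left_iff.mpr fun hμ => ?_).symm
  rw [Finset.mem_range, not_lt, Nat.succ_le_iff] at hμ
  rw [coeff_specialFiber, coeff_eq_zero_of_natDegree_lt hμ, eval_zero]

end Blowup

section NewtonSlope

lemma exists_min_slope (e : ℕ → ℕ) {μ : ℕ} {s : Finset ℕ} (hs : s.Nonempty)
    (hμ : ∀ j ∈ s, j < μ) :
    ∃ i ∈ s, ∀ j ∈ s, e i * (μ - j) ≤ e j * (μ - i) := by
  obtain ⟨i, hi, hmin⟩ :=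
    s.exists_min_image (fun j => (e j : ℚ) / ((μ - j : ℕ) : ℚ)) hs
  refine ⟨i, hi, fun j hj => ?_⟩
  have hpos : ∀ j ∈ s, (0 : ℚ) < ((μ - j : ℕ) : ℚ) := fun j hj =>
    Nat.cast_pos.mpr (Nat.sub_pos_of_lt (hμ j hj))
  exact_mod_cast (div_le_div_iff₀ (hpos i hi) (hpos j hj)).mp (hmin j hj)

lemma rootMultiplicity_lt_of_coeff_pred_eq_zero {R : Type*} [CommRing R] [IsDomain R] [CharZero R]
    {β : R[X]} {μ i : ℕ} (hdeg : β.natDegree ≤ μ) (hpred : β.coeff (μ - 1) = 0)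
    (hi : i < μ) (hβi : β.coeff i ≠ 0) (c : R) :
    β.rootMultiplicity c < μ := by
  have hβ : β ≠ 0 := fun h => hβi (by rw [h, coeff_zero])
  by_contra! hle
  have hpow : β = C β.leadingCoeff * (X - C c) ^ μ :=
    eq_leadingCoeff_mul_of_monic_of_dvd_of_natDegree_le ((monic_X_sub_C c).pow μ)
      ((le_rootMultiplicity_iff hβ).mp hle) (by simpa using hdeg)
  have hcoeff (j : ℕ) : β.coeff j = β.leadingCoeff * ((-c) ^ (μ - j) * μ.choose j) := by
    conv_lhs => rw [hpow, coeff_C_mul, sub_eq_add_neg, ← C_neg, coeff_X_add_C_pow]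
  have hc : c = 0 := by
    rw [hcoeff, Nat.sub_sub_self (Nat.one_le_of_lt hi)] at hpred
    simpa [hβ, (Nat.choose_pos (Nat.sub_le μ 1)).ne'] using hpred
  apply hβi
  rw [hcoeff, hc, neg_zero, zero_pow (Nat.sub_ne_zero_of_lt hi), zero_mul, mul_zero]

lemma coeff_pred_specialFiber_of_blowup_eq {m k μ : ℕ} {G G₁ : ℝ[X][X]} (hk : k < m) (hμ : 0 < μ)
    (h : blowup m k G = C (X ^ (k * μ)) * G₁) (hX : X ∣ G.coeff (μ - 1)) :
    (specialFiber G₁).coeff (μ - 1) = 0 := by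
  rw [coeff_specialFiber, ← coeff_zero_eq_eval_zero, ← X_dvd_iff]
  have hdvd : X ^ m ∣ X ^ k * G₁.coeff (μ - 1) := by
    have hexp := X_pow_dvd_expand m ((pow_one (X : ℝ[X])).symm ▸ hX)
    rwa [expand_coeff_of_blowup_eq h (Nat.sub_le μ 1), show μ - (μ - 1) = 1 by omega,
      mul_one, mul_one] at hexp
  rw [← Nat.add_sub_cancel' hk.le, pow_add] at hdvd
  exact (dvd_pow_self X (Nat.sub_ne_zero_of_lt hk)).trans
    ((mul_dvd_mul_iff_left (pow_ne_zero k X_ne_zero)).mp hdvd)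

/-- If some coefficient violates `X ^ (μ - j) ∣ G.coeff j`, the first side of the Newton polygon
has a slope less than one, and blowing up with that slope splits the zero of order `μ`. -/
lemma exists_blowup_rootMultiplicity_lt {G : ℝ[X][X]} {μ : ℕ} (hlow : ∀ j < μ, X ∣ G.coeff j)
    (h : ∃ j < μ, ¬ X ^ (μ - j) ∣ G.coeff j) :
    ∃ (m k : ℕ) (G₁ : ℝ[X][X]), m ≠ 0 ∧ k ≠ 0 ∧ blowup m k G = C (X ^ (k * μ)) * G₁ ∧
      ∀ c, (specialFiber G₁).rootMultiplicity c < μ := by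
  let e (j : ℕ) := (G.coeff j).natTrailingDegree
  have hdvd (j : ℕ) : X ^ e j ∣ G.coeff j :=
    X_pow_dvd_iff.mpr fun n hn => coeff_eq_zero_of_lt_natTrailingDegree hn
  obtain ⟨j, hjμ, hj⟩ := h
  have hj0 : G.coeff j ≠ 0 := fun h0 => hj (h0 ▸ dvd_zero _)
  obtain ⟨i, hi, hmin⟩ := exists_min_slope e (μ := μ)
    (s := (Finset.range μ).filter fun j => G.coeff j ≠ 0)
    ⟨j, by simp [hjμ, hj0]⟩ (by simp +contextual)
  simp only [Finset.mem_filter, Finset.mem_range] at hi hmin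
  have hslope : e i < μ - i := by
    have hej : e j < μ - j := not_le.mp fun hle => hj ((pow_dvd_pow X hle).trans (hdvd j))
    nlinarith [hmin j ⟨hjμ, hj0⟩, Nat.sub_pos_of_lt hi.1]
  have hμpos : 0 < μ := (Nat.zero_le j).trans_lt hjμ
  have he : e i ≠ 0 := natTrailingDegree_ne_zero.mpr ⟨hi.2, X_dvd_iff.mp (hlow i hi.1)⟩
  have hm : μ - i ≠ 0 := Nat.sub_ne_zero_of_lt hi.1
  obtain ⟨G₁, hG₁⟩ : ∃ G₁, blowup (μ - i) (e i) G = C (X ^ (e i * μ)) * G₁ := by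
    refine exists_blowup_eq fun j hj => ?_
    rcases eq_or_ne (G.coeff j) 0 with h0 | h0
    · rw [h0, map_zero]
      exact dvd_zero _
    · exact (pow_dvd_pow X ((hmin j ⟨hj, h0⟩).trans_eq (mul_comm _ _))).trans
        (X_pow_dvd_expand _ (hdvd j))
  refine ⟨μ - i, e i, G₁, hm, he, hG₁, fun c => ?_⟩
  refine rootMultiplicity_lt_of_coeff_pred_eq_zero (natDegree_specialFiber_of_blowup_eq he hG₁)
    ?_ hi.1 ?_ c
  · exact coeff_pred_specialFiber_of_blowup_eq hslope hμpos hG₁ (hlow _ (Nat.pred_lt hμpos.ne'))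
  · rw [coeff_specialFiber, ← coeff_zero_eq_eval_zero]
    have := congrArg (coeff · (e i * (μ - i))) (expand_coeff_of_blowup_eq hG₁ hi.1.le)
    simp only [coeff_expand_mul (Nat.pos_of_ne_zero hm), coeff_X_pow_mul', le_refl, if_true,
      Nat.sub_self] at this
    rw [← this]
    exact coeff_natTrailingDegree_ne_zero.mpr hi.2

end NewtonSlope

section LocalUniformization

/-- The filter of points `(t, v)` that tend to the origin within the half plane `t > 0`. -/
abbrev halfNhds : Filter (ℝ × ℝ) := 𝓝[>] 0 ×ˢ 𝓝 0

/-- The quotient `P / Q` is bounded near the origin in the half plane `t > 0`, and `Q` vanishes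
there at most to order `n` in `t`. This is what remains of a bounded rational function in a chart,
and unlike coprimality of `P` and `Q` it survives blowing up. -/
structure Dominates (P Q : ℝ[X][X]) (n : ℕ) : Prop where
  isBigO : (fun w : ℝ × ℝ => P.evalEval w.1 w.2) =O[halfNhds] fun w => Q.evalEval w.1 w.2
  pow_isBigO : (fun w : ℝ × ℝ => w.1 ^ n) =O[halfNhds] fun w => Q.evalEval w.1 w.2

/-- The number `d` is the limit of `P / Q` along a half branch `t = τ ^ m`, `v = h(τ)`, `τ > 0`, at
the origin. -/
def IsCurveLimit (P Q : ℝ[X][X]) (d : ℝ) : Prop :=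
  ∃ (m : ℕ) (h : ℝ[X]), m ≠ 0 ∧ h.eval 0 = 0 ∧
    Tendsto (fun τ => P.evalEval (τ ^ m) (h.eval τ) / Q.evalEval (τ ^ m) (h.eval τ))
      (𝓝[>] 0) (𝓝 d)

variable {P Q P₁ Q₁ : ℝ[X][X]} {m k n N μ : ℕ} {d : ℝ}

lemma tendsto_pow_nhdsGT (hm : m ≠ 0) : Tendsto (fun τ : ℝ => τ ^ m) (𝓝[>] 0) (𝓝[>] 0) :=
  tendsto_nhdsWithin_iff.mpr
    ⟨((continuous_pow m).tendsto' 0 0 (zero_pow hm)).mono_left nhdsWithin_le_nhds,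
      eventually_mem_nhdsWithin.mono fun τ (hτ : 0 < τ) => pow_pos hτ m⟩

lemma tendsto_blowup_halfNhds (hm : m ≠ 0) (hk : k ≠ 0) {ι : Type*} {l : Filter ι} {τ w : ι → ℝ}
    {c : ℝ} (hτ : Tendsto τ l (𝓝[>] 0)) (hw : Tendsto w l (𝓝 c)) :
    Tendsto (fun i => (τ i ^ m, τ i ^ k * w i)) l halfNhds := by
  refine ((tendsto_pow_nhdsGT hm).comp hτ).prodMk ?_
  simpa [zero_pow hk] using ((tendsto_nhdsWithin_iff.mp hτ).1.pow k).mul hw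

lemma Dominates.exists_blowup_eq (h : Dominates P Q n) (hm : m ≠ 0) (hk : k ≠ 0)
    (hQ : blowup m k Q = C (X ^ N) * Q₁) : ∃ P₁, blowup m k P = C (X ^ N) * P₁ := by
  refine C_X_pow_dvd_of_isBigO (H := Q₁) fun w => ?_
  have hfun : ∀ τ, τ ^ N * Q₁.evalEval τ w = Q.evalEval (τ ^ m) (τ ^ k * w) := fun τ => by
    rw [← evalEval_blowup, hQ, evalEval_mul, evalEval_C, eval_pow, eval_X]
  simp only [evalEval_blowup, hfun]
  exact h.isBigO.comp_tendsto (tendsto_blowup_halfNhds hm hk tendsto_id tendsto_const_nhds)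

lemma Dominates.of_X_pow_mul (h : Dominates (C (X ^ N) * P) (C (X ^ N) * Q) n) :
    Dominates P Q (n - N) := by
  have hpos : ∀ᶠ w : ℝ × ℝ in halfNhds, w.1 ∈ Set.Ioo 0 1 :=
    tendsto_fst.eventually (Ioo_mem_nhdsGT one_pos)
  obtain ⟨K, hK⟩ := h.isBigO.bound
  obtain ⟨L, hL⟩ := h.pow_isBigO.bound
  simp only [evalEval_mul, evalEval_C, eval_pow, eval_X, norm_mul, norm_pow] at hK hL
  refine ⟨.of_bound K ?_, .of_bound L ?_⟩
  · filter_upwards [hK, hpos] with w hw ⟨hw0, hw1⟩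
    rw [Real.norm_of_nonneg hw0.le] at hw
    exact le_of_mul_le_mul_left (by linarith) (pow_pos hw0 N)
  · filter_upwards [hL, hpos] with w hw ⟨hw0, hw1⟩
    rw [Real.norm_of_nonneg hw0.le] at hw
    rw [norm_pow, Real.norm_of_nonneg hw0.le]
    refine le_of_mul_le_mul_left ?_ (pow_pos hw0 N)
    calc w.1 ^ N * w.1 ^ (n - N) = w.1 ^ (N + (n - N)) := (pow_add _ _ _).symm
      _ ≤ w.1 ^ n := pow_le_pow_of_le_one hw0.le hw1.le (by omega)
      _ ≤ L * (w.1 ^ N * ‖Q.evalEval w.1 w.2‖) := hw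
      _ = w.1 ^ N * (L * ‖Q.evalEval w.1 w.2‖) := mul_left_comm _ _ _

lemma Dominates.taylor_of_blowup_eq (h : Dominates P Q n) (hm : m ≠ 0) (hk : k ≠ 0)
    (hP : blowup m k P = C (X ^ N) * P₁) (hQ : blowup m k Q = C (X ^ N) * Q₁) (c : ℝ) :
    Dominates (taylor (C c) P₁) (taylor (C c) Q₁) (m * n - N) := by
  have heval (G : ℝ[X][X]) (w : ℝ × ℝ) : (taylor (C c) (blowup m k G)).evalEval w.1 w.2 =
      G.evalEval (w.1 ^ m) (w.1 ^ k * (w.2 + c)) := by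
    rw [evalEval_taylor, evalEval_blowup, eval_C]
  have htendsto : Tendsto (fun w : ℝ × ℝ => (w.1 ^ m, w.1 ^ k * (w.2 + c))) halfNhds halfNhds :=
    tendsto_blowup_halfNhds hm hk tendsto_fst (tendsto_snd.add_const c)
  refine Dominates.of_X_pow_mul ?_
  rw [← taylor_C (C c) (X ^ N), ← taylor_mul, ← taylor_mul, ← hP, ← hQ]
  constructor
  · simpa only [heval] using! h.isBigO.comp_tendsto htendsto
  · simpa only [heval, pow_mul] using! h.pow_isBigO.comp_tendsto htendsto

lemma evalEval_div_of_blowup_eq (hP : blowup m k P = C (X ^ N) * P₁)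
    (hQ : blowup m k Q = C (X ^ N) * Q₁) {τ : ℝ} (hτ : τ ≠ 0) (w : ℝ) :
    P.evalEval (τ ^ m) (τ ^ k * w) / Q.evalEval (τ ^ m) (τ ^ k * w) =
      P₁.evalEval τ w / Q₁.evalEval τ w := by
  rw [← evalEval_blowup, ← evalEval_blowup, hP, hQ, evalEval_mul, evalEval_mul, evalEval_C,
    eval_pow, eval_X, mul_div_mul_left _ _ (pow_ne_zero N hτ)]

lemma IsCurveLimit.of_blowup_eq {c : ℝ} (h : IsCurveLimit (taylor (C c) P₁) (taylor (C c) Q₁) d)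
    (hm : m ≠ 0) (hk : k ≠ 0) (hP : blowup m k P = C (X ^ N) * P₁)
    (hQ : blowup m k Q = C (X ^ N) * Q₁) : IsCurveLimit P Q d := by
  obtain ⟨j, g, hj, -, hd⟩ := h
  refine ⟨j * m, X ^ (j * k) * (g + C c), mul_ne_zero hj hm, by simp [hj, hk], ?_⟩
  refine hd.congr' (eventually_mem_nhdsWithin.mono fun τ (hτ : 0 < τ) => ?_)
  simp only [evalEval_taylor, eval_C, eval_mul, eval_add, eval_pow, eval_X, pow_mul,
    evalEval_div_of_blowup_eq hP hQ (pow_pos hτ j).ne']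

lemma tendsto_div_of_blowup_eq (hm : m ≠ 0) (hP : blowup m k P = C (X ^ (k * μ)) * P₁)
    (hQ : blowup m k Q = C (X ^ (k * μ)) * Q₁) (hμ : (specialFiber Q).coeff μ ≠ 0)
    {ι : Type*} {l : Filter ι} {τ v : ι → ℝ} (hτ : Tendsto τ l (𝓝 0)) (hv : Tendsto v l (𝓝 0))
    (hv0 : ∀ᶠ i in l, v i ≠ 0) (hsteep : Tendsto (fun i => τ i ^ k / v i) l (𝓝 0)) :
    Tendsto (fun i => P.evalEval (τ i ^ m) (v i) / Q.evalEval (τ i ^ m) (v i)) l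
      (𝓝 ((specialFiber P).coeff μ / (specialFiber Q).coeff μ)) :=
  ((tendsto_div_pow_of_blowup_eq hm hP hτ hv hv0 hsteep).div
    (tendsto_div_pow_of_blowup_eq hm hQ hτ hv hv0 hsteep) hμ).congr'
    (hv0.mono fun _ hi => div_div_div_cancel_right₀ (pow_ne_zero μ hi) _ _)

lemma isCurveLimit_of_steep (hm : m ≠ 0) (hk : k ≠ 0)
    (hP : blowup m k P = C (X ^ (k * μ)) * P₁)
    (hQ : blowup m k Q = C (X ^ (k * μ)) * Q₁) (hμ : (specialFiber Q).coeff μ ≠ 0) :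
    IsCurveLimit P Q ((specialFiber P).coeff μ / (specialFiber Q).coeff μ) := by
  have hid : Tendsto (fun σ : ℝ => σ) (𝓝[>] 0) (𝓝 0) := nhdsWithin_le_nhds
  have hsteep : Tendsto (fun σ : ℝ => (σ ^ 2) ^ k / σ) (𝓝[>] 0) (𝓝 0) := by
    have hpow := hid.pow (2 * k - 1)
    rw [zero_pow (by omega)] at hpow
    refine hpow.congr' (eventually_mem_nhdsWithin.mono fun σ (hσ : 0 < σ) => ?_)
    simp only [← pow_mul]
    rw [eq_div_iff hσ.ne', ← pow_succ, Nat.sub_add_cancel (by omega)]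
  refine ⟨2 * m, X, by omega, eval_X, ?_⟩
  simp only [eval_X, pow_mul]
  exact tendsto_div_of_blowup_eq hm hP hQ hμ (by simpa using hid.pow 2) hid
    (eventually_mem_nhdsWithin.mono fun σ (hσ : 0 < σ) => hσ.ne') hsteep

lemma tendsto_rpow_inv_nhdsGT (hm : m ≠ 0) :
    Tendsto (fun t : ℝ => t ^ (m⁻¹ : ℝ)) (𝓝[>] 0) (𝓝[>] 0) := by
  refine tendsto_nhdsWithin_iff.mpr ⟨?_, ?_⟩
  · refine tendsto_nhdsWithin_of_tendsto_nhds ?_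
    simpa [hm] using (Real.continuousAt_rpow_const 0 (m⁻¹ : ℝ) (Or.inr (by positivity))).tendsto
  · exact eventually_mem_nhdsWithin.mono fun t (ht : 0 < t) => Real.rpow_pos_of_pos ht _

lemma tendsto_nhds_or_cobounded {ι : Type*} (U : Ultrafilter ι) (w : ι → ℝ) :
    (∃ c, Tendsto w U (𝓝 c)) ∨ Tendsto w U (Bornology.cobounded ℝ) := by
  refine or_iff_not_imp_right.mpr fun h => ?_
  obtain ⟨s, hs, hsU⟩ := Filter.not_le.mp h
  have hbdd : Bornology.IsBounded sᶜ := Bornology.isBounded_compl_iff.mpr hs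
  obtain ⟨c, -, hc⟩ := hbdd.isCompact_closure.ultrafilter_le_nhds (U.map w)
    (le_principal_iff.mpr (mem_of_superset (Ultrafilter.compl_mem_iff_notMem.mpr hsU)
      subset_closure))
  exact ⟨c, hc⟩

lemma tendsto_div_self_of_tendsto_cobounded {ι : Type*} {l : Filter ι} {a v : ι → ℝ}
    (h : Tendsto (fun i => v i / a i) l (Bornology.cobounded ℝ)) :
    (∀ᶠ i in l, v i ≠ 0) ∧ Tendsto (fun i => a i / v i) l (𝓝 0) := by
  refine ⟨(h.eventually (Bornology.eventually_ne_cobounded 0)).mono fun i hi => ?_, ?_⟩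
  · exact (div_ne_zero_iff.mp hi).1
  · simpa [Function.comp_def] using tendsto_inv₀_cobounded.comp h

lemma natTrailingDegree_specialFiber_taylor (G : ℝ[X][X]) (c : ℝ) :
    (specialFiber (taylor (C c) G)).natTrailingDegree = (specialFiber G).rootMultiplicity c := by
  rw [specialFiber_taylor, ← rootMultiplicity_eq_natTrailingDegree',
    rootMultiplicity_eq_rootMultiplicity (t := c), taylor_apply]

lemma Dominates.pos (h : Dominates P Q n) (h0 : (specialFiber Q).natTrailingDegree ≠ 0) :
    0 < n := by
  by_contra! hn
  obtain rfl : n = 0 := by omega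
  have hQ0 : Tendsto (fun w : ℝ × ℝ => Q.evalEval w.1 w.2) halfNhds (𝓝 0) := by
    have := tendsto_evalEval Q (tendsto_nhdsWithin_iff.mp tendsto_fst).1
      (tendsto_snd (f := 𝓝[>] (0 : ℝ)) (g := 𝓝 (0 : ℝ)))
    rwa [← eval_specialFiber, ← coeff_zero_eq_eval_zero, (natTrailingDegree_ne_zero.mp h0).2]
      at this
  have hone : Tendsto (fun _ : ℝ × ℝ => (1 : ℝ)) halfNhds (𝓝 0) := by
    simpa only [pow_zero] using h.pow_isBigO.trans_tendsto hQ0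
  exact one_ne_zero (tendsto_nhds_unique tendsto_const_nhds hone)

lemma isCurveLimit_of_eval_ne_zero {ι : Type*} {l : Filter ι} [l.NeBot] {t v : ι → ℝ}
    (hQ : Q.evalEval 0 0 ≠ 0) (ht : Tendsto t l (𝓝 0)) (hv : Tendsto v l (𝓝 0))
    (hd : Tendsto (fun i => P.evalEval (t i) (v i) / Q.evalEval (t i) (v i)) l (𝓝 d)) :
    IsCurveLimit P Q d := by
  have hlim : Tendsto (fun w : ℝ × ℝ => P.evalEval w.1 w.2 / Q.evalEval w.1 w.2) (𝓝 (0, 0))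
      (𝓝 (P.evalEval 0 0 / Q.evalEval 0 0)) :=
    ((continuous_evalEval P).tendsto (0, 0)).div ((continuous_evalEval Q).tendsto (0, 0)) hQ
  refine ⟨1, 0, one_ne_zero, eval_zero, ?_⟩
  rw [tendsto_nhds_unique hd (hlim.comp (ht.prodMk_nhds hv))]
  simp only [pow_one, eval_zero]
  exact hlim.comp ((tendsto_id'.mpr nhdsWithin_le_nhds).prodMk_nhds tendsto_const_nhds)

/-- One of the charts `w = v / τ ^ k` of a blow-up lowers the order of `Q(0, ·)` at the new centre,
or the blow-up is the ordinary one. -/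
lemma exists_blowup {G : ℝ[X][X]} (hμ : (specialFiber G).natTrailingDegree = μ) :
    ∃ (m k : ℕ) (G₁ : ℝ[X][X]), m ≠ 0 ∧ k ≠ 0 ∧ blowup m k G = C (X ^ (k * μ)) * G₁ ∧
      (m = 1 ∧ k = 1 ∨ ∀ c, (specialFiber G₁).rootMultiplicity c < μ) := by
  by_cases h : ∀ j < μ, X ^ (μ - j) ∣ G.coeff j
  · obtain ⟨G₁, hG₁⟩ := exists_blowup_eq (m := 1) (k := 1) (G := G) (μ := μ) (by simpa using h)
    exact ⟨1, 1, G₁, one_ne_zero, one_ne_zero, hG₁, Or.inl ⟨rfl, rfl⟩⟩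
  · push Not at h
    have hlow : ∀ j < μ, X ∣ G.coeff j := fun j hj => by
      rw [X_dvd_iff, coeff_zero_eq_eval_zero, ← coeff_specialFiber]
      exact coeff_eq_zero_of_lt_natTrailingDegree (hμ ▸ hj)
    obtain ⟨m, k, G₁, hm, hk, hG₁, hlt⟩ := exists_blowup_rootMultiplicity_lt hlow h
    exact ⟨m, k, G₁, hm, hk, hG₁, Or.inr hlt⟩

lemma exists_tendsto_taylor_or_isCurveLimit {ι : Type*} (U : Ultrafilter ι) (hm : m ≠ 0)
    (hk : k ≠ 0) (hP : blowup m k P = C (X ^ (k * μ)) * P₁)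
    (hQ : blowup m k Q = C (X ^ (k * μ)) * Q₁) (hμ : (specialFiber Q).coeff μ ≠ 0) {t v : ι → ℝ}
    (ht : Tendsto t U (𝓝[>] 0)) (hv : Tendsto v U (𝓝 0))
    (hd : Tendsto (fun i => P.evalEval (t i) (v i) / Q.evalEval (t i) (v i)) U (𝓝 d)) :
    (∃ (c : ℝ) (τ w : ι → ℝ), Tendsto τ U (𝓝[>] 0) ∧ Tendsto w U (𝓝 0) ∧
      Tendsto (fun i => (taylor (C c) P₁).evalEval (τ i) (w i) /
        (taylor (C c) Q₁).evalEval (τ i) (w i)) U (𝓝 d)) ∨ IsCurveLimit P Q d := by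
  let τ (i : ι) := t i ^ (m⁻¹ : ℝ)
  have hτ : Tendsto τ U (𝓝[>] 0) := (tendsto_rpow_inv_nhdsGT hm).comp ht
  obtain ⟨hτ0, hτpos⟩ := tendsto_nhdsWithin_iff.mp hτ
  have hτm : ∀ᶠ i in U, t i = τ i ^ m := (tendsto_nhdsWithin_iff.mp ht).2.mono fun i hi =>
    (Real.rpow_inv_natCast_pow (le_of_lt hi) hm).symm
  replace hd := hd.congr' (hτm.mono fun i hi => by rewrite [hi]; rfl)
  rcases tendsto_nhds_or_cobounded U fun i => v i / τ i ^ k with ⟨c, hc⟩ | hsteep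
  · refine Or.inl ⟨c, τ, fun i => v i / τ i ^ k - c, hτ, by simpa using hc.sub_const c, ?_⟩
    refine hd.congr' (hτpos.mono fun i (hi : 0 < τ i) => ?_)
    simp only [evalEval_taylor, eval_C, sub_add_cancel]
    rw [← evalEval_div_of_blowup_eq hP hQ hi.ne', mul_div_cancel₀ _ (pow_ne_zero k hi.ne')]
  · obtain ⟨hv0, hτv⟩ := tendsto_div_self_of_tendsto_cobounded hsteep
    rw [tendsto_nhds_unique hd (tendsto_div_of_blowup_eq hm hP hQ hμ hτ0 hv hv0 hτv)]
    exact Or.inr (isCurveLimit_of_steep hm hk hP hQ hμ)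

lemma rootMultiplicity_le_natDegree (p : ℝ[X]) (c : ℝ) :
    p.rootMultiplicity c ≤ p.natDegree := by
  rw [← count_roots]
  exact (Multiset.count_le_card c _).trans (card_roots' p)

/-- Blowing up lowers the pair (order of `Q(0, ·)` at `0`, order `n` of vanishing of `Q` in `t`)
lexicographically: a slope less than one lowers the first entry, and otherwise the ordinary blow-up
does not raise it and lowers `n`. -/
theorem Dominates.isCurveLimit {ι : Type*} (U : Ultrafilter ι) {P Q : ℝ[X][X]} {n : ℕ} {d : ℝ}
    (h : Dominates P Q n) (hQ : specialFiber Q ≠ 0) {t v : ι → ℝ} (ht : Tendsto t U (𝓝[>] 0))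
    (hv : Tendsto v U (𝓝 0))
    (hd : Tendsto (fun i => P.evalEval (t i) (v i) / Q.evalEval (t i) (v i)) U (𝓝 d)) :
    IsCurveLimit P Q d := by
  obtain ⟨μ, hμ⟩ : ∃ μ, (specialFiber Q).natTrailingDegree = μ := ⟨_, rfl⟩
  have hcoeff : (specialFiber Q).coeff μ ≠ 0 := hμ ▸ coeff_natTrailingDegree_ne_zero.mpr hQ
  by_cases hμ0 : μ = 0
  · rw [hμ0, coeff_zero_eq_eval_zero, eval_specialFiber] at hcoeff
    exact isCurveLimit_of_eval_ne_zero hcoeff (tendsto_nhdsWithin_iff.mp ht).1 hv hd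
  obtain ⟨m, k, Q₁, hm, hk, hQ₁, hdecr⟩ := exists_blowup hμ
  obtain ⟨P₁, hP₁⟩ := h.exists_blowup_eq hm hk hQ₁
  obtain ⟨c, τ, w, hτ, hw, hd₁⟩ | hd₁ :=
    exists_tendsto_taylor_or_isCurveLimit U hm hk hP₁ hQ₁ hcoeff ht hv hd
  swap
  · exact hd₁
  have hQ₂ : specialFiber (taylor (C c) Q₁) ≠ 0 := by
    rw [specialFiber_taylor, Ne, taylor_eq_zero]
    exact fun h0 => hcoeff (by rw [← coeff_specialFiber_of_blowup_eq hm hQ₁, h0, coeff_zero])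
  have hle : (specialFiber Q₁).rootMultiplicity c ≤ μ :=
    (rootMultiplicity_le_natDegree _ c).trans (natDegree_specialFiber_of_blowup_eq hk hQ₁)
  have := h.pos (hμ.trans_ne hμ0)
  exact (Dominates.isCurveLimit U (h.taylor_of_blowup_eq hm hk hP₁ hQ₁ c) hQ₂ hτ hw
    hd₁).of_blowup_eq hm hk hP₁ hQ₁
termination_by ((specialFiber Q).natTrailingDegree, n)
decreasing_by
  rw [natTrailingDegree_specialFiber_taylor, hμ, Prod.lex_def]
  obtain ⟨rfl, rfl⟩ | hlt := hdecr
  · exact hle.lt_or_eq.imp_right fun heq => ⟨heq, by simp only; omega⟩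
  · exact Or.inl (hlt c)

end LocalUniformization

section Cone

variable {P Q : ℝ[X][X]} {n : ℕ} {d : ℝ}

lemma Dominates.ne_zero (h : Dominates P Q n) : Q ≠ 0 := by
  rintro rfl
  have hpos : ∀ᶠ w : ℝ × ℝ in halfNhds, 0 < w.1 := tendsto_fst self_mem_nhdsWithin
  have hzero : (fun w : ℝ × ℝ => w.1 ^ n) =ᶠ[halfNhds] 0 := by
    simpa only [evalEval_zero, isBigO_zero_right_iff] using h.pow_isBigO
  obtain ⟨w, hw, hw0⟩ := (hpos.and hzero).exists
  exact (pow_pos hw n).ne' hw0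

lemma blowup_ne_zero {m : ℕ} (hm : m ≠ 0) (k : ℕ) (hQ : Q ≠ 0) : blowup m k Q ≠ 0 := fun h => by
  refine hQ (Polynomial.ext fun j => ?_)
  have hj := congrArg (coeff · j) h
  simpa [coeff_blowup, expand_eq_zero (Nat.pos_of_ne_zero hm)] using hj

theorem Dominates.exists_tendsto_of_abs_le {ι : Type*} (U : Ultrafilter ι) (h : Dominates P Q n)
    {t v : ι → ℝ} (ht : Tendsto t U (𝓝[>] 0)) (hcone : ∀ᶠ i in U, |v i| ≤ t i)
    (hd : Tendsto (fun i => P.evalEval (t i) (v i) / Q.evalEval (t i) (v i)) U (𝓝 d)) :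
    ∃ (m : ℕ) (g : ℝ[X]), m ≠ 0 ∧ Tendsto (fun τ => P.evalEval (τ ^ m) (τ ^ m * g.eval τ) /
      Q.evalEval (τ ^ m) (τ ^ m * g.eval τ)) (𝓝[>] 0) (𝓝 d) := by
  have hpos : ∀ᶠ i in U, 0 < t i := (tendsto_nhdsWithin_iff.mp ht).2
  obtain ⟨N, Q₁, hQ₁, hQ⟩ := exists_eq_C_X_pow_mul (blowup_ne_zero one_ne_zero 1 h.ne_zero)
  obtain ⟨P₁, hP⟩ := h.exists_blowup_eq one_ne_zero one_ne_zero hQ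
  have hslope : ∀ᶠ i in U, v i / t i ∈ Set.Icc (-1 : ℝ) 1 := by
    filter_upwards [hpos, hcone] with i hi hvi
    rw [Set.mem_Icc, ← abs_le, abs_div, abs_of_pos hi]
    exact div_le_one_of_le₀ hvi hi.le
  obtain ⟨c, -, hc⟩ := isCompact_Icc.ultrafilter_le_nhds (U.map fun i => v i / t i)
    (le_principal_iff.mpr hslope)
  have hd₁ : Tendsto (fun i => (taylor (C c) P₁).evalEval (t i) (v i / t i - c) /
      (taylor (C c) Q₁).evalEval (t i) (v i / t i - c)) U (𝓝 d) := by
    refine hd.congr' (hpos.mono fun i hi => ?_)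
    simpa [evalEval_taylor, mul_div_cancel₀ _ hi.ne'] using
      evalEval_div_of_blowup_eq hP hQ hi.ne' (v i / t i)
  have hfiber : specialFiber (taylor (C c) Q₁) ≠ 0 := by
    rwa [specialFiber_taylor, Ne, taylor_eq_zero]
  obtain ⟨m, g, hm, -, hg⟩ :=
    (h.taylor_of_blowup_eq one_ne_zero one_ne_zero hP hQ c).isCurveLimit U hfiber ht
      (by simpa using Tendsto.sub_const hc c) hd₁
  refine ⟨m, g + C c, hm, hg.congr' (eventually_mem_nhdsWithin.mono fun τ (hτ : 0 < τ) => ?_)⟩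
  simpa [evalEval_taylor] using
    (evalEval_div_of_blowup_eq hP hQ (pow_pos hτ m).ne' (g.eval τ + c)).symm

end Cone

section Elimination

variable {R : Type*} [CommRing R] [IsDomain R] [NormalizedGCDMonoid R] {p q : R[X]}

lemma isCoprime_map_of_isRelPrime (K : Type*) [Field K] [Algebra R K] [IsFractionRing R K]
    (h : IsRelPrime p q) : IsCoprime (p.map (algebraMap R K)) (q.map (algebraMap R K)) := by
  have hinj := IsFractionRing.injective R K
  refine isCoprime_of_irreducible_dvd (fun h0 => ?_) fun z hz hp hq => hz.not_isUnit ?_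
  · rw [Polynomial.map_eq_zero_iff hinj, Polynomial.map_eq_zero_iff hinj] at h0
    rw [h0.1, h0.2, isRelPrime_zero_left] at h
    exact not_isUnit_zero h
  let π := (IsLocalization.integerNormalization (nonZeroDivisors R) z).primPart
  have hπz : π.map (algebraMap R K) ∣ z := by
    obtain ⟨c, hc, hs⟩ := IsLocalization.integerNormalization_spec (nonZeroDivisors R) z
    rw [algebra_compatible_smul K c z, smul_eq_C_mul] at hs
    have hu : IsUnit (C (algebraMap R K c)) :=
      isUnit_C.mpr ((map_ne_zero_iff _ hinj).mpr (nonZeroDivisors.ne_zero hc)).isUnit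
    exact hu.dvd_mul_left.mp (hs ▸ Polynomial.map_dvd _ (primPart_dvd _))
  have hdvd {s : R[X]} (hs : z ∣ s.map (algebraMap R K)) : π ∣ s :=
    IsPrimitive.dvd_of_fraction_map_dvd_fraction_map (isPrimitive_primPart _) (hπz.trans hs)
  exact isUnit_or_eq_zero_of_isUnit_integerNormalization_primPart hz.ne_zero (h (hdvd hp) (hdvd hq))

lemma exists_mul_add_mul_eq_C_of_isRelPrime (h : IsRelPrime p q) :
    ∃ (a b : R[X]) (r : R), r ≠ 0 ∧ p * a + q * b = C r := by
  by_cases hdeg : p.natDegree ≠ 0 ∨ q.natDegree ≠ 0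
  · obtain ⟨a, b, -, -, hab⟩ := exists_mul_add_mul_eq_C_resultant p q le_rfl le_rfl hdeg
    refine ⟨a, b, _, fun h0 => ?_, hab⟩
    have hinj := IsFractionRing.injective R (FractionRing R)
    refine resultant_ne_zero _ _ (isCoprime_map_of_isRelPrime (FractionRing R) h) ?_
    rw [natDegree_map_eq_of_injective hinj, natDegree_map_eq_of_injective hinj, resultant_map_map,
      h0, map_zero]
  · push Not at hdeg
    obtain ⟨⟨a, rfl⟩, b, rfl⟩ := And.imp natDegree_eq_zero.mp natDegree_eq_zero.mp hdeg
    rcases eq_or_ne a 0 with rfl | ha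
    · refine ⟨0, 1, b, fun hb => ?_, by simp⟩
      rw [hb, map_zero, isRelPrime_zero_left] at h
      exact not_isUnit_zero h
    · exact ⟨1, 0, a, ha, by simp⟩

end Elimination

section Charts

/-- Polynomial coordinates `(t, v)` of the plane that are centred at `z`, given by the isomorphism
that rewrites a polynomial in `x` and `y` as a polynomial in `v` over `ℝ[t]`. -/
structure Chart (z : ℝ × ℝ) where
  pullback : Poly2 ≃ₐ[ℝ] ℝ[X][X]
  evalEval_pullback_zero (p : Poly2) : (pullback p).evalEval 0 0 = pval p z

lemma algHom_eq_pval (φ : Poly2 →ₐ[ℝ] ℝ) (p : Poly2) :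
    φ p = pval p (φ (.X 0), φ (.X 1)) := by
  rw [pval, ← MvPolynomial.coe_aeval_eq_eval]
  have : φ = MvPolynomial.aeval ![φ (.X 0), φ (.X 1)] :=
    MvPolynomial.algHom_ext fun i => by fin_cases i <;> simp
  exact DFunLike.congr_fun this p

lemma algHom_eq_evalEval (φ : ℝ[X][X] →ₐ[ℝ] ℝ) (G : ℝ[X][X]) :
    φ G = G.evalEval (φ (C X)) (φ X) := by
  rw [← coe_aevalAeval_eq_evalEval]
  have : φ = aevalAeval (R := ℝ) (φ (C X)) (φ X) := by ext <;> simp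
  exact DFunLike.congr_fun this G

namespace Chart

variable {z : ℝ × ℝ} (T : Chart z)

/-- The point of the plane with given coordinates. -/
def point (w : ℝ × ℝ) : ℝ × ℝ :=
  ((T.pullback (.X 0)).evalEval w.1 w.2, (T.pullback (.X 1)).evalEval w.1 w.2)

/-- The coordinates of a given point of the plane. -/
def coord (w : ℝ × ℝ) : ℝ × ℝ :=
  (pval (T.pullback.symm (C X)) w, pval (T.pullback.symm X) w)

lemma evalEval_pullback (p : Poly2) (w : ℝ × ℝ) :
    (T.pullback p).evalEval w.1 w.2 = pval p (T.point w) := by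
  have := algHom_eq_pval ((aevalAeval w.1 w.2).comp T.pullback.toAlgHom) p
  simpa [point, coe_aevalAeval_eq_evalEval] using this

lemma pval_pullback_symm (G : ℝ[X][X]) (w : ℝ × ℝ) :
    pval (T.pullback.symm G) w = G.evalEval (T.coord w).1 (T.coord w).2 := by
  have := algHom_eq_evalEval ((MvPolynomial.aeval ![w.1, w.2]).comp T.pullback.symm.toAlgHom) G
  simpa [coord, pval, MvPolynomial.coe_aeval_eq_eval] using this

lemma point_coord (w : ℝ × ℝ) : T.point (T.coord w) = w := by
  simp [point, ← pval_pullback_symm, pval]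

lemma coord_point (w : ℝ × ℝ) : T.coord (T.point w) = w := by
  simp [coord, ← evalEval_pullback, evalEval]

lemma point_zero : T.point 0 = z := by
  simp [point, evalEval_pullback_zero, pval]

lemma coord_center : T.coord z = 0 := by
  simpa only [point_zero] using T.coord_point 0

lemma continuous_point : Continuous T.point :=
  (continuous_evalEval _).prodMk (continuous_evalEval _)

lemma continuous_coord : Continuous T.coord :=
  (continuous_pval _).prodMk (continuous_pval _)

lemma point_ne {w : ℝ × ℝ} (hw : w ≠ 0) : T.point w ≠ z := by
  intro h
  exact hw (by rw [← T.coord_point w, h, coord_center])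

lemma isRelPrime_pullback {p q : Poly2} (h : IsRelPrime p q) :
    IsRelPrime (T.pullback p) (T.pullback q) := fun G hp hq => by
  have hG : IsUnit (T.pullback.symm G) := h (by simpa using map_dvd T.pullback.symm hp)
    (by simpa using map_dvd T.pullback.symm hq)
  simpa using hG

end Chart

variable (z : ℝ × ℝ) (s : ℝˣ)

/-- The coordinates `x = z₁ + s t`, `y = z₂ + v`. -/
def horizontalChart : Chart z where
  pullback := AlgEquiv.ofAlgHom
    (MvPolynomial.aeval ![C (C z.1 + C (s : ℝ) * X), C (C z.2) + X])
    (aevalAeval (MvPolynomial.C (s⁻¹ : ℝ) * (.X 0 - MvPolynomial.C z.1))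
      (.X 1 - MvPolynomial.C z.2))
    (by
      refine Polynomial.algHom_ext' (Polynomial.algHom_ext ?_) ?_
      · have hs : (C (C (s⁻¹ : ℝ)) * C (C (s : ℝ)) : ℝ[X][X]) = 1 := by simp [← C_mul, -map_mul]
        simp [← mul_assoc, hs]
      · simp)
    (by
      refine MvPolynomial.algHom_ext fun i => ?_
      fin_cases i
      · simp [← mul_assoc, ← MvPolynomial.C_mul]
      · simp)
  evalEval_pullback_zero p := by
    have := algHom_eq_pval ((aevalAeval (0 : ℝ) 0).comp
      (MvPolynomial.aeval ![C (C z.1 + C (s : ℝ) * X), C (C z.2) + X])) p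
    simpa [coe_aevalAeval_eq_evalEval, evalEval_C] using this

lemma point_horizontalChart (w : ℝ × ℝ) :
    (horizontalChart z s).point w = (z.1 + s * w.1, z.2 + w.2) := by
  simp [Chart.point, horizontalChart, evalEval]

lemma coord_horizontalChart (w : ℝ × ℝ) :
    (horizontalChart z s).coord w = (s⁻¹ * (w.1 - z.1), w.2 - z.2) := by
  simp [Chart.coord, horizontalChart, pval]

lemma pval_rename_swap (p : Poly2) (w : ℝ × ℝ) :
    pval (MvPolynomial.rename (Equiv.swap 0 1) p) w = pval p w.swap := by
  rw [pval, MvPolynomial.eval_rename, pval]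
  congr 2
  ext i
  fin_cases i <;> simp

/-- The coordinates `x = z₁ + v`, `y = z₂ + s t`. -/
def verticalChart : Chart z where
  pullback := (MvPolynomial.renameEquiv ℝ (Equiv.swap 0 1)).trans
    (horizontalChart z.swap s).pullback
  evalEval_pullback_zero p := by
    simp [Chart.evalEval_pullback_zero, pval_rename_swap]

lemma point_verticalChart (w : ℝ × ℝ) :
    (verticalChart z s).point w = (z.1 + w.2, z.2 + s * w.1) := by
  simp [Chart.point, verticalChart, horizontalChart, evalEval]

lemma coord_verticalChart (w : ℝ × ℝ) :
    (verticalChart z s).coord w = (s⁻¹ * (w.2 - z.2), w.1 - z.1) := by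
  simp [Chart.coord, verticalChart, horizontalChart, pval]

/-- The charts at `z` whose cones `|v| ≤ t` cover the plane. -/
def axisCharts : Set (Chart z) :=
  {horizontalChart z 1, horizontalChart z (-1), verticalChart z 1, verticalChart z (-1)}

lemma exists_mem_axisCharts {z w : ℝ × ℝ} (hw : w ≠ z) :
    ∃ T ∈ axisCharts z, 0 < (T.coord w).1 ∧ |(T.coord w).2| ≤ (T.coord w).1 := by
  have hcone {a b : ℝ} (ha : a ≠ 0) (hb : |b| ≤ |a|) : 0 < a ∧ |b| ≤ a ∨ 0 < -a ∧ |b| ≤ -a := by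
    rcases ha.lt_or_gt with h | h
    · exact Or.inr ⟨neg_pos.mpr h, abs_of_neg h ▸ hb⟩
    · exact Or.inl ⟨h, abs_of_pos h ▸ hb⟩
  simp only [axisCharts, Set.mem_insert_iff, Set.mem_singleton_iff, exists_eq_or_imp,
    exists_eq_left, coord_horizontalChart, coord_verticalChart, Units.val_one, Units.val_neg,
    inv_neg, inv_one, neg_mul, one_mul]
  rcases le_total |w.2 - z.2| |w.1 - z.1| with h | h
  · have h0 : w.1 - z.1 ≠ 0 := fun h0 => hw <| Prod.ext (sub_eq_zero.mp h0) <| by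
      simpa [h0, sub_eq_zero] using h
    exact (hcone h0 h).elim Or.inl (Or.inr ∘ Or.inl)
  · have h0 : w.2 - z.2 ≠ 0 := fun h0 => hw <| Prod.ext (by simpa [h0, sub_eq_zero] using h) <|
      sub_eq_zero.mp h0
    exact Or.inr (Or.inr (hcone h0 h))

lemma exists_mem_axisCharts_eventually {z : ℝ × ℝ} (U : Ultrafilter (ℝ × ℝ))
    (hU : (U : Filter (ℝ × ℝ)) ≤ 𝓝[≠] z) :
    ∃ T ∈ axisCharts z, ∀ᶠ w in U, 0 < (T.coord w).1 ∧ |(T.coord w).2| ≤ (T.coord w).1 := by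
  have hfin : (axisCharts z).Finite := by simp [axisCharts]
  rw [← Ultrafilter.eventually_exists_mem_iff hfin]
  filter_upwards [hU self_mem_nhdsWithin] with w hw using exists_mem_axisCharts hw

end Charts

section BoundedRational

variable {f : Rat2} {z : ℝ × ℝ}

lemma isRelPrime_num_den (f : Rat2) : IsRelPrime (num f) (den f) :=
  IsFractionRing.num_den_reduced Poly2 f

lemma BoundedNear.isBigO (hf : BoundedNear f z) : pval (num f) =O[𝓝 z] pval (den f) := by
  obtain ⟨K, hK⟩ := hf
  refine IsBigO.of_bound K ?_
  filter_upwards [hK.eventually_nhds] with w hw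
  let s := {v | ‖pval (num f) v‖ ≤ K * ‖pval (den f) v‖}
  have hs : IsClosed s :=
    isClosed_le (continuous_pval _).norm (continuous_const.mul (continuous_pval _).norm)
  refine hs.mem_of_frequently_of_tendsto (((mem_closure_iff_frequently.mp
    (dense_pval_ne_zero (den_ne_zero f) w)).and_eventually hw).mono ?_) tendsto_id
  rintro v ⟨h0, hv⟩
  exact (div_le_iff₀ (norm_pos_iff.mpr h0)).mp ((norm_div _ _).symm.trans_le (hv h0))

lemma exists_pow_isBigO_eval {r : ℝ[X]} (hr : r ≠ 0) :
    ∃ n : ℕ, (fun t : ℝ => t ^ n) =O[𝓝 0] fun t => r.eval t := by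
  obtain ⟨n, s, hs, rfl⟩ := exists_eq_X_pow_mul hr
  have hone : (fun _ : ℝ => (1 : ℝ)) =O[𝓝 0] fun t => s.eval t :=
    (isBigO_const_left_iff_pos_le_norm one_ne_zero).mpr ⟨_, half_pos (norm_pos_iff.mpr hs),
      (s.continuous.tendsto 0).norm.eventually_const_le (half_lt_self (norm_pos_iff.mpr hs))⟩
  exact ⟨n, by simpa using (isBigO_refl (fun t : ℝ => t ^ n) (𝓝 0)).mul hone⟩

lemma Chart.dominates (T : Chart z) (hf : BoundedNear f z) :
    ∃ n, Dominates (T.pullback (num f)) (T.pullback (den f)) n := by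
  have hpoint : Tendsto T.point halfNhds (𝓝 z) := by
    refine (T.continuous_point.tendsto' 0 z T.point_zero).mono_left ?_
    rw [Prod.zero_eq_mk, nhds_prod_eq]
    exact prod_mono nhdsWithin_le_nhds le_rfl
  have hPQ : (fun w : ℝ × ℝ => (T.pullback (num f)).evalEval w.1 w.2) =O[halfNhds]
      fun w => (T.pullback (den f)).evalEval w.1 w.2 := by
    simpa only [T.evalEval_pullback] using! hf.isBigO.comp_tendsto hpoint
  obtain ⟨_⟩ : Nonempty (NormalizedGCDMonoid ℝ[X]) := inferInstance
  obtain ⟨a, b, r, hr, hab⟩ :=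
    exists_mul_add_mul_eq_C_of_isRelPrime (T.isRelPrime_pullback (isRelPrime_num_den f))
  obtain ⟨n, hn⟩ := exists_pow_isBigO_eval hr
  have hbdd (G : ℝ[X][X]) :
      (fun w : ℝ × ℝ => G.evalEval w.1 w.2) =O[halfNhds] fun _ => (1 : ℝ) :=
    (tendsto_evalEval G (tendsto_nhdsWithin_iff.mp tendsto_fst).1 tendsto_snd).isBigO_one ℝ
  refine ⟨n, hPQ, ?_⟩
  calc (fun w : ℝ × ℝ => w.1 ^ n)
      =O[halfNhds] fun w => r.eval w.1 :=
        hn.comp_tendsto (tendsto_nhdsWithin_iff.mp tendsto_fst).1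
    _ = fun w => (T.pullback (num f)).evalEval w.1 w.2 * a.evalEval w.1 w.2 +
          (T.pullback (den f)).evalEval w.1 w.2 * b.evalEval w.1 w.2 := by
        funext w
        simpa [evalEval_C] using congrArg (evalEval w.1 w.2) hab.symm
    _ =O[halfNhds] fun w => (T.pullback (den f)).evalEval w.1 w.2 := by
        simpa using (hPQ.mul (hbdd a)).add ((isBigO_refl _ _).mul (hbdd b))

lemma Chart.evalEval_pullback_coord (T : Chart z) (p : Poly2) (w : ℝ × ℝ) :
    (T.pullback p).evalEval (T.coord w).1 (T.coord w).2 = pval p w := by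
  rw [T.evalEval_pullback, T.point_coord]

lemma Chart.tendsto_coord_halfNhds (T : Chart z) {l : Filter (ℝ × ℝ)} (hl : l ≤ 𝓝 z)
    (hpos : ∀ᶠ w in l, 0 < (T.coord w).1) : Tendsto T.coord l halfNhds :=
  have h := (T.continuous_coord.tendsto' z 0 T.coord_center).mono_left hl
  (tendsto_nhdsWithin_iff.mpr ⟨h.fst_nhds, hpos⟩).prodMk h.snd_nhds

lemma BoundedNear.eventually_den_ne_zero (hf : BoundedNear f z) :
    ∀ᶠ w in 𝓝[≠] z, pval (den f) w ≠ 0 := by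
  refine mem_iff_ultrafilter.mpr fun U hU => ?_
  obtain ⟨T, -, hT⟩ := exists_mem_axisCharts_eventually U hU
  have hpos := hT.mono fun _ => And.left
  obtain ⟨n, hn⟩ := T.dominates hf
  have hbig : (fun w => (T.coord w).1 ^ n) =O[U] pval (den f) := by
    simpa only [Function.comp_def, T.evalEval_pullback_coord] using
      hn.pow_isBigO.comp_tendsto (T.tendsto_coord_halfNhds (hU.trans nhdsWithin_le_nhds) hpos)
  filter_upwards [hpos, hbig.eq_zero_imp] with w hw himp h0
  exact (pow_pos hw n).ne' (himp h0)

lemma BoundedNear.eventually_value_eq (hf : BoundedNear f z) :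
    ∀ᶠ w in 𝓝[≠] z, value f w = quot f w :=
  hf.eventually_den_ne_zero.mono fun _ hw => if_pos hw

lemma exists_tendsto_div_of_isBigO {A B : ℝ[X]} {l : Filter ℝ} [l.NeBot] (hl : l ≤ 𝓝[≠] 0)
    (h : (fun t => A.eval t) =O[l] fun t => B.eval t) :
    ∃ L, Tendsto (fun t => A.eval t / B.eval t) l (𝓝 L) := by
  rcases eq_or_ne B 0 with rfl | hB
  · exact ⟨0, by simp only [eval_zero, div_zero, tendsto_const_nhds]⟩
  obtain ⟨n, s, hs, rfl⟩ := exists_eq_X_pow_mul hB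
  obtain ⟨A, rfl⟩ := X_pow_dvd_of_isBigO hl (by simpa using h)
  refine ⟨A.eval 0 / s.eval 0, (((A.continuous.tendsto 0).div (s.continuous.tendsto 0)
    hs).mono_left (hl.trans nhdsWithin_le_nhds)).congr' ?_⟩
  filter_upwards [hl self_mem_nhdsWithin] with t ht
  simp only [Pi.div_apply, eval_mul, eval_pow, eval_X, mul_div_mul_left _ _ (pow_ne_zero n ht)]

lemma Chart.exists_tendsto_quot_point (T : Chart z) (hf : BoundedNear f z) {a b : ℝ[X]}
    (ha : a.eval 0 = 0) (hb : b.eval 0 = 0) {l : Filter ℝ} [l.NeBot] (hl : l ≤ 𝓝[≠] 0) :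
    ∃ L, Tendsto (fun t => quot f (T.point (a.eval t, b.eval t))) l (𝓝 L) := by
  have heval (p : Poly2) (t : ℝ) : (aevalAeval a b (T.pullback p)).eval t =
      pval p (T.point (a.eval t, b.eval t)) := by
    rw [← T.evalEval_pullback]
    simpa [coe_aeval_eq_eval] using
      algHom_eq_evalEval ((Polynomial.aeval t).comp (aevalAeval (R := ℝ) a b)) (T.pullback p)
  have hpoint : Tendsto (fun t => T.point (a.eval t, b.eval t)) l (𝓝 z) :=
    ((T.continuous_point.comp (a.continuous.prodMk b.continuous)).tendsto' 0 z
      (by simp only [Function.comp_apply, ha, hb]; exact T.point_zero)).mono_left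
      (hl.trans nhdsWithin_le_nhds)
  simpa only [heval] using! exists_tendsto_div_of_isBigO (A := aevalAeval a b (T.pullback (num f)))
    (B := aevalAeval a b (T.pullback (den f))) hl
    (by simpa only [heval] using! hf.isBigO.comp_tendsto hpoint)

lemma continuousAt_quot {w : ℝ × ℝ} (hw : pval (den f) w ≠ 0) : ContinuousAt (quot f) w :=
  (continuous_pval _).continuousAt.div (continuous_pval _).continuousAt hw

lemma tendsto_mk_nhdsNE (z : ℝ × ℝ) : Tendsto (fun x => (x, z.2)) (𝓝[≠] z.1) (𝓝[≠] z) :=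
  tendsto_nhdsWithin_iff.mpr
    ⟨((continuous_id.prodMk continuous_const).tendsto' _ _ rfl).mono_left nhdsWithin_le_nhds,
      eventually_mem_nhdsWithin.mono fun _ hx h => hx (congrArg Prod.fst h)⟩

lemma BoundedNear.exists_tendsto_horizontal (hf : BoundedNear f z) :
    ∃ L, Tendsto (fun x => quot f (x, z.2)) (𝓝[≠] z.1) (𝓝 L) := by
  obtain ⟨L, hL⟩ := (horizontalChart z 1).exists_tendsto_quot_point hf (a := X) (b := 0)
    eval_X eval_zero (l := 𝓝[≠] 0) le_rfl
  refine ⟨L, ?_⟩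
  have hsub : Tendsto (fun x => x - z.1) (𝓝[≠] z.1) (𝓝[≠] 0) :=
    tendsto_nhdsWithin_iff.mpr ⟨((continuous_id.sub continuous_const).tendsto' _ _
      (sub_self z.1)).mono_left nhdsWithin_le_nhds,
      eventually_mem_nhdsWithin.mono fun _ => sub_ne_zero.mpr⟩
  simpa [Function.comp_def, point_horizontalChart] using hL.comp hsub

lemma BoundedNear.tendsto_horizontal (hf : BoundedNear f z) :
    Tendsto (fun x => quot f (x, z.2)) (𝓝[≠] z.1) (𝓝 (value f z)) := by
  by_cases h0 : pval (den f) z = 0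
  · obtain ⟨L, hL⟩ := hf.exists_tendsto_horizontal
    have hinner : ∀ᶠ x in 𝓝[≠] z.1,
        (limUnder (𝓝[≠] z.2) fun y => quot f (x, y)) = quot f (x, z.2) := by
      filter_upwards [(tendsto_mk_nhdsNE z).eventually hf.eventually_den_ne_zero] with x hx
      exact ((continuousAt_quot hx).tendsto.comp (((continuous_const.prodMk continuous_id).tendsto'
        _ _ rfl).mono_left nhdsWithin_le_nhds)).limUnder_eq
    rwa [value, if_neg (not_not.mpr h0), (hL.congr' (hinner.mono fun _ h => h.symm)).limUnder_eq]
  · rw [value, if_pos h0]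
    exact (continuousAt_quot h0).tendsto.comp ((tendsto_mk_nhdsNE z).mono_right nhdsWithin_le_nhds)

lemma BoundedNear.mapClusterPt_of_mem_limitingValues (hf : BoundedNear f z) {d : ℝ}
    (hd : d ∈ limitingValues f z) : MapClusterPt d (𝓝[≠] z) (quot f) := by
  rw [mapClusterPt_iff_frequently]
  intro s hs hev
  obtain ⟨s', hs's, hs'o, hds'⟩ := mem_nhds_iff.mp hs
  have h1 := eventually_nhdsWithin_iff.mp (hev.and hf.eventually_value_eq)
  obtain ⟨-, hv, w, hw, rfl⟩ := mem_closure_iff.mp (Set.mem_iInter₂.mp hd _ h1) s' hs'o hds'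
  by_cases hwz : w = z
  · subst hwz
    obtain ⟨x, hx, hx'⟩ := ((hf.tendsto_horizontal.eventually (hs'o.mem_nhds hv)).and
      ((tendsto_mk_nhdsNE w).eventually hev)).exists
    exact hx' (hs's hx)
  · have h2 := hw hwz
    exact h2.1 (hs's (h2.2 ▸ hv))

end BoundedRational

section Characters

variable {z : ℝ × ℝ} {ι : Type} {l : Filter ι} {γ : ι → ℝ × ℝ}

lemma quot_eq_div {f : Rat2} {a b : Poly2} {w : ℝ × ℝ}
    (hf : f = algebraMap Poly2 Rat2 a / algebraMap Poly2 Rat2 b) (hb : pval b w ≠ 0)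
    (hd : pval (den f) w ≠ 0) : quot f w = pval a w / pval b w := by
  have inj := IsFractionRing.injective Poly2 Rat2
  have hb0 : b ≠ 0 := by
    rintro rfl
    exact hb (map_zero _)
  have hcross : num f * b = a * den f := inj <| by
    simpa only [map_mul] using (div_eq_div_iff ((map_ne_zero_iff _ inj).mpr (den_ne_zero f))
      ((map_ne_zero_iff _ inj).mpr hb0)).mp ((num_div_den f).trans hf)
  rw [quot, div_eq_div_iff hd hb]
  simpa only [pval, map_mul] using congrArg (pval · w) hcross

lemma quot_mul {f g : Rat2} {w : ℝ × ℝ} (hf : pval (den f) w ≠ 0) (hg : pval (den g) w ≠ 0)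
    (hfg : pval (den (f * g)) w ≠ 0) : quot (f * g) w = quot f w * quot g w := by
  rw [quot_eq_div (a := num f * num g) (b := den f * den g) _ _ hfg]
  · simp only [pval, quot, map_mul, mul_div_mul_comm]
  · rw [map_mul, map_mul, mul_div_mul_comm, num_div_den, num_div_den]
  · simpa only [pval, map_mul] using mul_ne_zero hf hg

lemma quot_add {f g : Rat2} {w : ℝ × ℝ} (hf : pval (den f) w ≠ 0) (hg : pval (den g) w ≠ 0)
    (hfg : pval (den (f + g)) w ≠ 0) : quot (f + g) w = quot f w + quot g w := by
  have inj := IsFractionRing.injective Poly2 Rat2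
  rw [quot_eq_div (a := num f * den g + den f * num g) (b := den f * den g) _ _ hfg]
  · rw [quot, quot, div_add_div _ _ hf hg]
    simp only [pval, map_add, map_mul]
  · rw [map_mul, map_add, map_mul, map_mul, ← div_add_div _ _
        ((map_ne_zero_iff _ inj).mpr (den_ne_zero f))
        ((map_ne_zero_iff _ inj).mpr (den_ne_zero g)), num_div_den, num_div_den]
  · simpa only [pval, map_mul] using mul_ne_zero hf hg

lemma quot_algebraMap {c : ℝ} {w : ℝ × ℝ} (h : pval (den (algebraMap ℝ Rat2 c)) w ≠ 0) :
    quot (algebraMap ℝ Rat2 c) w = c := by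
  rw [quot_eq_div (a := MvPolynomial.C c) (b := 1) _ _ h]
  · simp [pval]
  · rw [map_one, div_one]
    exact IsScalarTower.algebraMap_apply ℝ Poly2 Rat2 c
  · simp [pval]

/-- The character of limits along a family of points along which every locally bounded rational
function has a limit. -/
def limitCharacter [l.NeBot] (hγ : Tendsto γ l (𝓝[≠] z)) {L : boundedRat z → ℝ}
    (hL : ∀ g : boundedRat z, Tendsto (fun i => quot (g : Rat2) (γ i)) l (𝓝 (L g))) :
    Character z :=
  have hden (g : boundedRat z) : ∀ᶠ i in l, pval (den (g : Rat2)) (γ i) ≠ 0 :=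
    hγ.eventually (BoundedNear.eventually_den_ne_zero g.2)
  have hconst (c : ℝ) : L (algebraMap ℝ (boundedRat z) c) = c :=
    tendsto_nhds_unique (hL _) <| tendsto_const_nhds.congr' <|
      (hden (algebraMap ℝ _ c)).mono fun _ h => (quot_algebraMap h).symm
  { toFun := L
    map_one' := by simpa only [map_one] using hconst 1
    map_zero' := by simpa only [map_zero] using hconst 0
    map_mul' f g := tendsto_nhds_unique (hL (f * g)) <| ((hL f).mul (hL g)).congr' <| by
      filter_upwards [hden f, hden g, hden (f * g)] with i hf hg hfg
      exact (quot_mul hf hg hfg).symm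
    map_add' f g := tendsto_nhds_unique (hL (f + g)) <| ((hL f).add (hL g)).congr' <| by
      filter_upwards [hden f, hden g, hden (f + g)] with i hf hg hfg
      exact (quot_add hf hg hfg).symm
    commutes' := hconst }

lemma exists_determinedAlong [l.NeBot] (hγ : Tendsto γ l (𝓝[≠] z))
    (h : ∀ g, BoundedNear g z → ∃ L, Tendsto (fun i => quot g (γ i)) l (𝓝 L)) :
    ∃ χ : Character z, DeterminedAlong χ l γ := by
  choose L hL using fun g : boundedRat z => h g g.2
  exact ⟨limitCharacter hγ hL, hγ.mono_right nhdsWithin_le_nhds, fun g => (hL g).congr' <|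
    (hγ.eventually (BoundedNear.eventually_value_eq g.2)).mono fun _ => Eq.symm⟩

lemma DeterminedAlong.comp {χ : Character z} {κ : Type} {l' : Filter κ} {σ : κ → ι}
    (h : DeterminedAlong χ l γ) (hσ : Tendsto σ l' l) : DeterminedAlong χ l' (γ ∘ σ) :=
  ⟨h.1.comp hσ, fun g => (h.2 g).comp hσ⟩

lemma DeterminedAlong.congr' {χ : Character z} {γ' : ι → ℝ × ℝ} (h : DeterminedAlong χ l γ)
    (hγ : γ =ᶠ[l] γ') : DeterminedAlong χ l γ' :=
  ⟨h.1.congr' hγ, fun g => (h.2 g).congr' (hγ.fun_comp (value g))⟩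

lemma DeterminedAlong.apply_eq [l.NeBot] {χ : Character z} (h : DeterminedAlong χ l γ)
    (hγ : Tendsto γ l (𝓝[≠] z)) {f : Rat2} (hf : BoundedNear f z) {d : ℝ}
    (hd : Tendsto (fun i => quot f (γ i)) l (𝓝 d)) : χ ⟨f, hf⟩ = d :=
  tendsto_nhds_unique (h.2 ⟨f, hf⟩) <|
    hd.congr' <| (hγ.eventually hf.eventually_value_eq).mono fun _ => Eq.symm

end Characters

section PuiseuxSums

variable {Φ : ℝ → ℝ}

lemma exists_puiseuxSum {m : ℕ} (hm : m ≠ 0) (g : ℝ[X]) :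
    ∃ Φ ∈ puiseuxSums, ∀ τ, 0 ≤ τ → Φ (τ ^ m) = τ ^ m * g.eval τ := by
  let e := g.support.orderEmbOfFin rfl
  have : (0 : ℚ) < m := mod_cast Nat.pos_of_ne_zero hm
  refine ⟨_, ⟨_, fun k => g.coeff (e k), fun k => 1 + e k / m, fun k => ?_, fun k => ?_, ?_, rfl⟩,
    fun τ hτ => ?_⟩
  · exact mem_support_iff.mp (g.support.orderEmbOfFin_mem rfl k)
  · exact le_add_of_nonneg_right (by positivity)
  · intro i j hij
    have : ((e i : ℕ) : ℚ) < (e j : ℕ) := mod_cast e.strictMono hij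
    beta_reduce
    gcongr
  · have hterm (i : ℕ) : |τ ^ m| ^ ((1 + i / m : ℚ) : ℝ) = τ ^ m * τ ^ i := by
      have hmi : (m : ℝ) * ((1 + i / m : ℚ) : ℝ) = (m + i : ℕ) := by
        have : (m : ℝ) ≠ 0 := mod_cast hm
        push_cast
        field_simp
      rw [abs_of_nonneg (pow_nonneg hτ m), ← Real.rpow_natCast_mul hτ, hmi, Real.rpow_natCast,
        pow_add]
    have hsum := Finset.sum_map Finset.univ e.toEmbedding fun i => g.coeff i * τ ^ i
    rw [Finset.map_orderEmbOfFin_univ] at hsum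
    simp only [hterm, eval_eq_sum, Polynomial.sum_def, hsum, Finset.mul_sum]
    exact Finset.sum_congr rfl fun k _ => mul_left_comm _ _ _

lemma even_of_mem_puiseuxSums (hΦ : Φ ∈ puiseuxSums) : Function.Even Φ := by
  obtain ⟨N, φ, e, -, -, -, rfl⟩ := hΦ
  exact fun t => by simp only [abs_neg]

lemma exists_tendsto_div_abs_of_mem_puiseuxSums (hΦ : Φ ∈ puiseuxSums) :
    ∃ c, Tendsto (fun t => Φ t / |t|) (𝓝[≠] 0) (𝓝 c) := by
  obtain ⟨N, φ, e, -, he, -, rfl⟩ := hΦ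
  refine ⟨∑ k, φ k * |0| ^ ((e k : ℝ) - 1), Tendsto.congr' ?_ ((Continuous.tendsto
    (f := fun t : ℝ => ∑ k, φ k * |t| ^ ((e k : ℝ) - 1)) ?_ 0).mono_left nhdsWithin_le_nhds)⟩
  · filter_upwards [self_mem_nhdsWithin] with t ht
    simp only [Real.rpow_sub_one (abs_ne_zero.mpr ht), Finset.sum_div, mul_div_assoc]
  · have he' (k : Fin N) : 0 ≤ (e k : ℝ) - 1 := sub_nonneg.mpr (mod_cast he k)
    exact continuous_finsetSum _ fun k _ =>
      continuous_const.mul (continuous_abs.rpow_const fun _ => Or.inr (he' k))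

lemma flatToPuiseuxSum_of_tendsto {ι : Type} {l : Filter ι} {u : ι → ℝ} (hΦ : Φ ∈ puiseuxSums)
    (hsign : (∀ i, 0 < u i) ∨ ∀ i, u i < 0) (hu : Tendsto u l (𝓝 0)) :
    FlatToPuiseuxSum l u (fun i => Φ (u i)) := by
  refine ⟨hsign, ?_, Φ, hΦ, fun e => by simp only [sub_self, zero_div, tendsto_const_nhds]⟩
  obtain ⟨c, hc⟩ := exists_tendsto_div_abs_of_mem_puiseuxSums hΦ
  have hne (i : ι) : u i ≠ 0 := hsign.elim (fun h => (h i).ne') fun h => (h i).ne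
  have hcu := hc.comp (tendsto_nhdsWithin_iff.mpr ⟨hu, Eventually.of_forall hne⟩)
  rcases hsign with h | h
  · exact ⟨c, hcu.congr fun i => by simp only [Function.comp_apply, abs_of_pos (h i)]⟩
  · exact ⟨-c, hcu.neg.congr fun i => by
      simp only [Function.comp_apply, abs_of_neg (h i), div_neg, neg_neg]⟩

lemma exists_seq_tendsto_nhdsGT_flatToPuiseuxSum (hΦ : Φ ∈ puiseuxSums) (x : ℝ) :
    ∃ u : ℕ → ℝ, Tendsto u atTop (𝓝[>] x) ∧
      FlatToPuiseuxSum atTop (fun n => u n - x) (fun n => Φ (u n - x)) := by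
  obtain ⟨u, -, hux, hu⟩ := exists_seq_strictAnti_tendsto x
  exact ⟨u, tendsto_nhdsWithin_iff.mpr ⟨hu, Eventually.of_forall hux⟩,
    flatToPuiseuxSum_of_tendsto hΦ (Or.inl fun n => sub_pos.mpr (hux n))
      (tendsto_sub_nhds_zero_iff.mpr hu)⟩

lemma exists_seq_tendsto_nhdsLT_flatToPuiseuxSum (hΦ : Φ ∈ puiseuxSums) (x : ℝ) :
    ∃ u : ℕ → ℝ, Tendsto u atTop (𝓝[<] x) ∧
      FlatToPuiseuxSum atTop (fun n => u n - x) (fun n => Φ (u n - x)) := by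
  obtain ⟨u, -, hux, hu⟩ := exists_seq_strictMono_tendsto x
  exact ⟨u, tendsto_nhdsWithin_iff.mpr ⟨hu, Eventually.of_forall hux⟩,
    flatToPuiseuxSum_of_tendsto hΦ (Or.inr fun n => sub_neg.mpr (hux n))
      (tendsto_sub_nhds_zero_iff.mpr hu)⟩

end PuiseuxSums

section Branches

variable {x₀ y₀ : ℝ} {z : ℝ × ℝ} {f : Rat2} {Φ : ℝ → ℝ} {d : ℝ}

lemma DeterminedByGraphX.mem_X1 {χ : Character (x₀, y₀)} (h : DeterminedByGraphX χ Φ)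
    (hΦ : Φ ∈ puiseuxSums) : χ ∈ X1 x₀ y₀ := by
  obtain ⟨u, hu, hflat⟩ : ∃ u : ℕ → ℝ,
      DeterminedAlong χ atTop ((fun x => (x, y₀ + Φ (x - x₀))) ∘ u) ∧
      FlatToPuiseuxSum atTop (fun n => u n - x₀) (fun n => Φ (u n - x₀)) := by
    rcases h with h | h
    · exact (exists_seq_tendsto_nhdsGT_flatToPuiseuxSum hΦ x₀).imp fun _ => .imp_left h.comp
    · exact (exists_seq_tendsto_nhdsLT_flatToPuiseuxSum hΦ x₀).imp fun _ => .imp_left h.comp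
  exact ⟨ℕ, inferInstance, inferInstance, inferInstance, _, hu, Or.inl <| by
    simpa only [Function.comp_apply, add_sub_cancel_left] using hflat⟩

lemma DeterminedByGraphY.mem_X1 {χ : Character (x₀, y₀)} (h : DeterminedByGraphY χ Φ)
    (hΦ : Φ ∈ puiseuxSums) : χ ∈ X1 x₀ y₀ := by
  obtain ⟨u, hu, hflat⟩ : ∃ u : ℕ → ℝ,
      DeterminedAlong χ atTop ((fun y => (x₀ + Φ (y - y₀), y)) ∘ u) ∧
      FlatToPuiseuxSum atTop (fun n => u n - y₀) (fun n => Φ (u n - y₀)) := by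
    rcases h with h | h
    · exact (exists_seq_tendsto_nhdsGT_flatToPuiseuxSum hΦ y₀).imp fun _ => .imp_left h.comp
    · exact (exists_seq_tendsto_nhdsLT_flatToPuiseuxSum hΦ y₀).imp fun _ => .imp_left h.comp
  exact ⟨ℕ, inferInstance, inferInstance, inferInstance, _, hu, Or.inr <| by
    simpa only [Function.comp_apply, add_sub_cancel_left] using hflat⟩

lemma tendsto_sub_nhdsGT (x : ℝ) : Tendsto (fun t => t - x) (𝓝[>] x) (𝓝[>] 0) :=
  tendsto_nhdsWithin_iff.mpr ⟨((continuous_id.sub continuous_const).tendsto' _ _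
    (sub_self x)).mono_left nhdsWithin_le_nhds,
    eventually_mem_nhdsWithin.mono fun _ (ht : x < _) => sub_pos.mpr ht⟩

lemma tendsto_sub_nhdsLT (x : ℝ) : Tendsto (fun t => x - t) (𝓝[<] x) (𝓝[>] 0) :=
  tendsto_nhdsWithin_iff.mpr ⟨((continuous_const.sub continuous_id).tendsto' _ _
    (sub_self x)).mono_left nhdsWithin_le_nhds,
    eventually_mem_nhdsWithin.mono fun _ (ht : _ < x) => sub_pos.mpr ht⟩

lemma DeterminedAlong.determinedByGraphX_or_determinedByGraphY {χ : Character (x₀, y₀)}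
    {T : Chart (x₀, y₀)} (hT : T ∈ axisCharts (x₀, y₀)) (hΦ : Function.Even Φ)
    (h : DeterminedAlong χ (𝓝[>] 0) fun u => T.point (u, Φ u)) :
    DeterminedByGraphX χ Φ ∨ DeterminedByGraphY χ Φ := by
  have hsub (x t : ℝ) : Φ (x - t) = Φ (t - x) := by rw [← hΦ, neg_sub]
  rcases hT with rfl | rfl | rfl | rfl
  · exact Or.inl <| Or.inl <| by
      simpa [Function.comp_def, point_horizontalChart] using h.comp (tendsto_sub_nhdsGT x₀)
  · exact Or.inl <| Or.inr <| by
      simpa [Function.comp_def, point_horizontalChart, hsub x₀] using h.comp (tendsto_sub_nhdsLT x₀)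
  · exact Or.inr <| Or.inl <| by
      simpa [Function.comp_def, point_verticalChart] using h.comp (tendsto_sub_nhdsGT y₀)
  · exact Or.inr <| Or.inr <| by
      simpa [Function.comp_def, point_verticalChart, hsub y₀] using h.comp (tendsto_sub_nhdsLT y₀)

lemma Chart.tendsto_point_curve (T : Chart z) {m : ℕ} (hm : m ≠ 0) (g : ℝ[X]) :
    Tendsto (fun τ => T.point (τ ^ m, τ ^ m * g.eval τ)) (𝓝[>] 0) (𝓝[≠] z) := by
  refine tendsto_nhdsWithin_iff.mpr
    ⟨(Continuous.tendsto' ?_ 0 z ?_).mono_left nhdsWithin_le_nhds, ?_⟩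
  · exact T.continuous_point.comp (by fun_prop)
  · rw [zero_pow hm, zero_mul]
    exact T.point_zero
  · filter_upwards [self_mem_nhdsWithin] with τ (hτ : 0 < τ)
    exact T.point_ne fun h => (pow_pos hτ m).ne' (congrArg Prod.fst h)

lemma Chart.exists_determinedAlong (T : Chart z) {m : ℕ} (hm : m ≠ 0) (g : ℝ[X]) :
    ∃ χ : Character z,
      DeterminedAlong χ (𝓝[>] 0) fun τ => T.point (τ ^ m, τ ^ m * g.eval τ) :=
  RatLim.exists_determinedAlong (T.tendsto_point_curve hm g) fun f hf => by
    have hlim := T.exists_tendsto_quot_point hf (a := X ^ m) (b := X ^ m * g)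
      (by simp [hm]) (by simp [hm]) (nhdsGT_le_nhdsNE 0)
    simpa only [eval_mul, eval_pow, eval_X] using hlim

lemma BoundedNear.exists_curve (hf : BoundedNear f z) (U : Ultrafilter (ℝ × ℝ))
    (hU : (U : Filter (ℝ × ℝ)) ≤ 𝓝[≠] z) (hd : Tendsto (quot f) U (𝓝 d)) :
    ∃ T ∈ axisCharts z, ∃ (m : ℕ) (g : ℝ[X]), m ≠ 0 ∧
      Tendsto (fun τ => quot f (T.point (τ ^ m, τ ^ m * g.eval τ))) (𝓝[>] 0) (𝓝 d) := by
  obtain ⟨T, hT, hcone⟩ := exists_mem_axisCharts_eventually U hU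
  obtain ⟨n, hn⟩ := T.dominates hf
  have hcoord := T.tendsto_coord_halfNhds (hU.trans nhdsWithin_le_nhds)
    (hcone.mono fun _ => And.left)
  obtain ⟨m, g, hm, hg⟩ := hn.exists_tendsto_of_abs_le U (tendsto_fst.comp hcoord)
    (hcone.mono fun _ => And.right)
    (by simpa only [Function.comp_apply, T.evalEval_pullback_coord] using! hd)
  exact ⟨T, hT, m, g, hm, by simpa only [quot, ← T.evalEval_pullback] using hg⟩

theorem BoundedNear.exists_character (hf : BoundedNear f z) (U : Ultrafilter (ℝ × ℝ))
    (hU : (U : Filter (ℝ × ℝ)) ≤ 𝓝[≠] z) (hd : Tendsto (quot f) U (𝓝 d)) :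
    ∃ χ : Character z, χ ⟨f, hf⟩ = d ∧ ∃ Φ ∈ puiseuxSums, ∃ T ∈ axisCharts z,
      DeterminedAlong χ (𝓝[>] 0) fun u => T.point (u, Φ u) := by
  obtain ⟨T, hT, m, g, hm, hg⟩ := hf.exists_curve U hU hd
  obtain ⟨χ, hχ⟩ := T.exists_determinedAlong hm g
  obtain ⟨Φ, hΦ, hΦg⟩ := exists_puiseuxSum hm g
  refine ⟨χ, hχ.apply_eq (T.tendsto_point_curve hm g) hf hg, Φ, hΦ, T, hT,
    (hχ.comp (tendsto_rpow_inv_nhdsGT hm)).congr' ?_⟩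
  filter_upwards [self_mem_nhdsWithin] with u (hu : 0 < u)
  have hroot : (u ^ (m : ℝ)⁻¹) ^ m = u := Real.rpow_inv_natCast_pow hu.le hm
  have hΦu := hΦg _ (Real.rpow_nonneg hu.le (m : ℝ)⁻¹)
  rw [hroot] at hΦu
  simp only [Function.comp_apply, hroot, hΦu]

end Branches

end RatLim

end

theorem theorem4 (x₀ y₀ : ℝ) (f : RatLim.Rat2) (hf : f ∈ RatLim.boundedRat (x₀, y₀))
    (d : ℝ) (hd : d ∈ RatLim.limitingValues f (x₀, y₀)) :
    ∃ χ ∈ RatLim.X1 x₀ y₀, χ ⟨f, hf⟩ = d ∧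
      ∃ Φ ∈ RatLim.puiseuxSums,
        RatLim.DeterminedByGraphX χ Φ ∨ RatLim.DeterminedByGraphY χ Φ := by
  have hbdd : RatLim.BoundedNear f (x₀, y₀) := hf
  obtain ⟨U, hU, hUd⟩ :=
    mapClusterPt_iff_ultrafilter.mp (hbdd.mapClusterPt_of_mem_limitingValues hd)
  obtain ⟨χ, hχd, Φ, hΦ, T, hT, hχ⟩ := hbdd.exists_character U hU hUd
  have hgraph : RatLim.DeterminedByGraphX χ Φ ∨ RatLim.DeterminedByGraphY χ Φ :=
    hχ.determinedByGraphX_or_determinedByGraphY hT (RatLim.even_of_mem_puiseuxSums hΦ)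
  exact ⟨χ, hgraph.elim (·.mem_X1 hΦ) (·.mem_X1 hΦ), hχd, Φ, hΦ, hgraph⟩
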